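/- Let $\alpha$ be an indeterminate, let $0\le N\le n$ be integers, and let $\Lambda_n^N\otimes\mathbb Q(\alpha)$ be the space of symmetric polynomials in $x_1,\dots,x_n$ over $\mathbb Q(\alpha)$ that are homogeneous of degree $N$. It has as basis the power sums $p_\lambda=p_{\lambda_1}p_{\lambda_2}\cdots$ with $p_i=\sum_k x_k^i$, where $\lambda$ runs over the partitions of $N$; let $\langle\cdot,\cdot\rangle$ be the bilinear form on it with $$\langle p_\lambda,p_\mu\rangle=\delta_{\lambda\mu}\,z_\lambda\,\alpha^{\ell(\lambda)},\qquad z_\lambda=\prod_{i\ge1} i^{m_i}\,m_i!,$$ where $m_i$ is the number of parts of $\lambda$ equal to $i$ and $\ell(\lambda)$ is the number of parts. Let $m_\mu$ be the symmetric monomials and let $\le$ be the dominance order on partitions of $N$. Let $J_\lambda=J_\lambda(x_1,\dots,x_n;\alpha)\in\Lambda_n^N\otimes\mathbb Q(\alpha)$ ($\lambda$ a partition of $N$) be the Jack polynomials, i.e. the family specified by (i) $\langle J_\lambda,J_\mu\rangle=0$ if $\lambda\ne\mu$; (ii) $J_\lambda=\sum_{\mu\le\lambda}v_{\lambda\mu}(\alpha)\,m_\mu$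 with $v_{\lambda\mu}(\alpha)\in\mathbb Q(\alpha)$; (iii) $v_{\lambda,1^N}(\alpha)=N!$. Then for all partitions $\mu\le\lambda$ of $N$ the coefficient $v_{\lambda\mu}(\alpha)$ is a polynomial in $\alpha$ with integer coefficients. -/

import Mathlib

namespace JackPoly

open MvPolynomial

/-- The field `ℚ(α)` of rational functions in one parameter. -/
abbrev Qα : Type := RatFunc ℚ

/-- The parameter `α`. -/
noncomputable abbrev α : Qα := RatFunc.X

/-! ### Partitions -/

section Partitions

variable {N : ℕ}

/-- `λ₁ + ⋯ + λᵢ`, where `λ₁ ≥ λ₂ ≥ ⋯` are the parts of `lam` (extended by zeros). -/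
def partialSum (lam : N.Partition) (i : ℕ) : ℕ :=
  ((lam.parts.sort (· ≥ ·)).take i).sum

/-- Dominance order: `DomLE μ λ` means `μ ≤ λ`. -/
def DomLE (mu lam : N.Partition) : Prop :=
  ∀ i, partialSum mu i ≤ partialSum lam i

/-- The number of parts `ℓ(λ)`. -/
def len (lam : N.Partition) : ℕ := lam.parts.card

/-- `z_λ = 1^{m₁} m₁! 2^{m₂} m₂! ⋯`, with `mᵢ` the multiplicity of `i` in `λ`. -/
def zee (lam : N.Partition) : ℕ :=
  ∏ i ∈ lam.parts.toFinset, i ^ lam.parts.count i * (lam.parts.count i).factorial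

/-- The partition `1^N`. -/
def onePart (N : ℕ) : N.Partition where
  parts := Multiset.replicate N 1
  parts_pos := by
    intro i hi
    rw [Multiset.eq_of_mem_replicate hi]
    exact Nat.one_pos
  parts_sum := by simp

end Partitions

/-! ### Homogeneous symmetric polynomials and the power sum basis -/

/-- The homogeneous component of degree `N` of `Λ_n ⊗ ℚ(α)`: symmetric polynomials in
`x₁, …, x_n` over `ℚ(α)`, homogeneous of degree `N`. -/
noncomputable def SymHom (n N : ℕ) : Submodule Qα (MvPolynomial (Fin n) Qα) :=
  Subalgebra.toSubmodule (symmetricSubalgebra (Fin n) Qα) ⊓ homogeneousSubmodule (Fin n) Qα N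

/-- The multiset of nonzero exponents of a monomial. -/
def vals {n : ℕ} (d : Fin n →₀ ℕ) : Multiset ℕ := d.support.val.map d

lemma vals_sum {n : ℕ} (d : Fin n →₀ ℕ) : (vals d).sum = d.degree := rfl

lemma vals_single_add {n : ℕ} (e : Fin n →₀ ℕ) (i : Fin n) {a : ℕ} (ha : 0 < a)
    (hi : e i = 0) : vals (Finsupp.single i a + e) = a ::ₘ vals e := by
  classical
  have hs : (Finsupp.single i a + e).support = insert i e.support := by
    ext j
    by_cases h : j = i
    · subst h; simp [ha.ne']
    · simp [h]
  have hni : i ∉ e.support := by simpa using hi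
  unfold vals
  rw [hs, Finset.insert_val_of_notMem hni, Multiset.map_cons]
  congr 1
  · simp [hi]
  · apply Multiset.map_congr rfl
    intro j hj
    have : j ≠ i := by
      rintro rfl; exact hni hj
    simp [this.symm]

lemma card_vals {n : ℕ} (d : Fin n →₀ ℕ) : (vals d).card = d.support.card := by
  simp [vals]

lemma psum_support {n : ℕ} {R : Type*} [CommSemiring R] {a : ℕ} {d : Fin n →₀ ℕ}
    (hd : coeff d (psum (Fin n) R a) ≠ 0) : ∃ i, d = Finsupp.single i a := by
  classical
  by_contra! h
  apply hd
  simp only [psum, coeff_sum, coeff_X_pow]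
  exact Finset.sum_eq_zero fun i _ => if_neg (fun h' => h i h'.symm)

/-- A monomial of a product of power sums has at most as many variables as there are factors,
and if it has as many, its exponents are those of the factors. -/
lemma vals_of_coeff_ne {n : ℕ} {R : Type*} [CommSemiring R] (s : Multiset ℕ) :
    (∀ a ∈ s, 0 < a) → ∀ d : Fin n →₀ ℕ, coeff d ((s.map (psum (Fin n) R)).prod) ≠ 0 →
      (vals d).card ≤ s.card ∧ ((vals d).card = s.card → vals d = s) := by
  classical
  induction s using Multiset.induction with
  | empty =>
    intro _ d hd
    have : d = 0 := by
      by_contra h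
      apply hd
      simp [coeff_one, Ne.symm h]
    subst this
    simp [vals]
  | cons a s ih =>
    intro hpos d hd
    rw [Multiset.map_cons, Multiset.prod_cons, coeff_mul] at hd
    obtain ⟨⟨x, e⟩, hxe, hne⟩ := Finset.exists_ne_zero_of_sum_ne_zero hd
    obtain ⟨i, hi⟩ := psum_support (left_ne_zero_of_mul hne)
    have he := ih (fun b hb => hpos b (Multiset.mem_cons_of_mem hb)) e
      (right_ne_zero_of_mul hne)
    have hd' : d = Finsupp.single i a + e := by
      rw [← Finset.HasAntidiagonal.mem_antidiagonal.mp hxe, ← hi]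
    have ha : 0 < a := hpos a (Multiset.mem_cons_self a s)
    by_cases hei : e i = 0
    · rw [hd', vals_single_add e i ha hei]
      simp only [Multiset.card_cons]
      refine ⟨by omega, fun h => ?_⟩
      rw [he.2 (by omega)]
    · have hs : (Finsupp.single i a + e).support = e.support := by
        ext j
        by_cases h : j = i
        · subst h; simp [hei]
        · simp [Ne.symm h]
      have hc : (vals d).card = (vals e).card := by
        rw [card_vals, card_vals, hd', hs]
      rw [hc, Multiset.card_cons]
      exact ⟨by omega, fun h => by omega⟩

lemma coeff_prod_psum_nat {n : ℕ} (s : Multiset ℕ) :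
    (∀ a ∈ s, 0 < a) → ∀ d : Fin n →₀ ℕ, vals d = s →
      coeff d ((s.map (psum (Fin n) ℕ)).prod) ≠ 0 := by
  classical
  induction s using Multiset.induction with
  | empty =>
    intro _ d hd
    have : d = 0 := by
      simpa [vals] using hd
    subst this
    simp
  | cons a s ih =>
    intro hpos d hd
    have ha : 0 < a := hpos a (Multiset.mem_cons_self a s)
    have hmem : a ∈ vals d := by rw [hd]; exact Multiset.mem_cons_self a s
    obtain ⟨i, -, hi⟩ := Multiset.mem_map.mp hmem
    have hdec : Finsupp.single i a + d.erase i = d := by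
      rw [← hi, Finsupp.single_add_erase]
    have hv : vals (d.erase i) = s := by
      have := vals_single_add (d.erase i) i ha (by simp)
      rw [hdec, hd] at this
      exact ((Multiset.cons_inj_right a).mp this).symm
    have h1 := ih (fun b hb => hpos b (Multiset.mem_cons_of_mem hb)) _ hv
    rw [Multiset.map_cons, Multiset.prod_cons, coeff_mul]
    intro h0
    have h2 := (Finset.sum_eq_zero_iff.mp h0) (Finsupp.single i a, d.erase i)
      (Finset.HasAntidiagonal.mem_antidiagonal.mpr hdec)
    rcases mul_eq_zero.mp h2 with h | h
    · simp only [psum, coeff_sum, coeff_X_pow] at h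
      have := (Finset.sum_eq_zero_iff.mp h) i (Finset.mem_univ i)
      simp at this
    · exact h1 h

lemma coeff_prod_psum {n : ℕ} (s : Multiset ℕ) (hs : ∀ a ∈ s, 0 < a) (d : Fin n →₀ ℕ)
    (hd : vals d = s) : coeff d ((s.map (psum (Fin n) Qα)).prod) ≠ 0 := by
  have h : (s.map (psum (Fin n) Qα)).prod
      = MvPolynomial.map (Nat.castRingHom Qα) ((s.map (psum (Fin n) ℕ)).prod) := by
    rw [← Multiset.prod_hom, Multiset.map_map]
    congr 1
    apply Multiset.map_congr rfl
    intro a _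
    simp [psum]
  rw [h, coeff_map]
  simpa using coeff_prod_psum_nat s hs d hd

/-- Every multiset of at most `n` positive integers is the multiset of nonzero exponents of a
monomial in `n` variables. -/
lemma exists_vals {n : ℕ} (s : Multiset ℕ) :
    (∀ a ∈ s, 0 < a) → s.card ≤ n → ∃ d : Fin n →₀ ℕ, vals d = s := by
  classical
  induction s using Multiset.induction with
  | empty => exact fun _ _ => ⟨0, by simp [vals]⟩
  | cons a s ih =>
    intro hpos hc
    rw [Multiset.card_cons] at hc
    obtain ⟨e, he⟩ := ih (fun b hb => hpos b (Multiset.mem_cons_of_mem hb)) (by omega)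
    have hcard : e.support.card < (Finset.univ : Finset (Fin n)).card := by
      rw [← card_vals, he]; simp; omega
    obtain ⟨i, -, hi⟩ := Finset.exists_mem_notMem_of_card_lt_card hcard
    refine ⟨Finsupp.single i a + e, ?_⟩
    rw [vals_single_add e i (hpos a (Multiset.mem_cons_self a s)) (by simpa using hi), he]

lemma card_parts_le {N : ℕ} (lam : N.Partition) : lam.parts.card ≤ N := by
  have h := Multiset.card_nsmul_le_sum (s := lam.parts) (a := 1)
    (fun x hx => lam.parts_pos hx)
  rw [lam.parts_sum] at h
  simpa using h

lemma psumPart_mem {n N : ℕ} (lam : N.Partition) : psumPart (Fin n) Qα lam ∈ SymHom n N := by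
  refine ⟨?_, ?_⟩
  · change psumPart (Fin n) Qα lam ∈ symmetricSubalgebra (Fin n) Qα
    apply Subalgebra.multiset_prod_mem
    intro p hp
    obtain ⟨a, -, rfl⟩ := Multiset.mem_map.mp hp
    exact psum_isSymmetric _ _ a
  · change (psumPart (Fin n) Qα lam).IsHomogeneous N
    have key : ∀ s : Multiset ℕ, ((s.map (psum (Fin n) Qα)).prod).IsHomogeneous s.sum := by
      intro s
      induction s using Multiset.induction with
      | empty => simpa using isHomogeneous_one (Fin n) Qα
      | cons a s ih =>
        rw [Multiset.map_cons, Multiset.prod_cons, Multiset.sum_cons]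
        refine IsHomogeneous.mul ?_ ih
        exact IsHomogeneous.sum _ _ _ fun i _ => isHomogeneous_X_pow i a
    have := key lam.parts
    rwa [lam.parts_sum] at this

/-- The power sum `p_λ` as an element of the degree `N` component. -/
noncomputable def pElt (n : ℕ) {N : ℕ} (lam : N.Partition) : SymHom n N :=
  ⟨psumPart (Fin n) Qα lam, psumPart_mem lam⟩

lemma pElt_linearIndependent {n N : ℕ} (h : N ≤ n) :
    LinearIndependent Qα (pElt n : N.Partition → SymHom n N) := by
  classical
  rw [Fintype.linearIndependent_iff]
  intro g hg
  by_contra! hne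
  obtain ⟨i₀, hi₀⟩ := hne
  obtain ⟨lam, hlam, hmax⟩ := Finset.exists_max_image
    (Finset.univ.filter fun mu : N.Partition => g mu ≠ 0) (fun mu => mu.parts.card)
    ⟨i₀, by simpa using hi₀⟩
  obtain ⟨d, hd⟩ := exists_vals (n := n) lam.parts (fun a ha => lam.parts_pos ha)
    ((card_parts_le lam).trans h)
  have hg' : ∑ mu : N.Partition, g mu * coeff d (psumPart (Fin n) Qα mu) = 0 := by
    have := congrArg (fun f : SymHom n N => coeff d (f : MvPolynomial (Fin n) Qα)) hg
    simpa [pElt, coeff_sum] using this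
  rw [Finset.sum_eq_single lam] at hg'
  · rcases mul_eq_zero.mp hg' with h1 | h1
    · exact (Finset.mem_filter.mp hlam).2 h1
    · exact coeff_prod_psum lam.parts (fun a ha => lam.parts_pos ha) d hd h1
  · intro mu _ hmu
    by_contra hc
    have hgm := left_ne_zero_of_mul hc
    have h1 := vals_of_coeff_ne mu.parts (fun a ha => mu.parts_pos ha) d
      (right_ne_zero_of_mul hc)
    have h2 := hmax mu (by simpa using hgm)
    rw [hd] at h1
    exact hmu (Nat.Partition.ext (h1.2 (le_antisymm h1.1 h2)).symm)
  · simp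

/-- Two monomials with the same multiset of nonzero exponents differ by a permutation of the
variables. -/
lemma exists_perm {n : ℕ} (d e : Fin n →₀ ℕ) (h : vals d = vals e) :
    ∃ σ : Equiv.Perm (Fin n), d.mapDomain σ = e := by
  classical
  have hfib : ∀ c : ℕ, Fintype.card {i // d i = c} = Fintype.card {i // e i = c} := by
    have hpos : ∀ c : ℕ, c ≠ 0 → ∀ f : Fin n →₀ ℕ,
        Fintype.card {i // f i = c} = (vals f).count c := by
      intro c hc f
      rw [Fintype.card_subtype, vals, Multiset.count_map, ← Finset.filter_val, Finset.card_val]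
      congr 1
      ext i
      simp only [Finset.mem_filter, Finset.mem_univ, true_and, Finsupp.mem_support_iff]
      constructor
      · intro hi; exact ⟨by rw [hi]; exact hc, hi.symm⟩
      · intro hi; exact hi.2.symm
    have hzero : ∀ f : Fin n →₀ ℕ, Fintype.card {i // f i = 0} = n - (vals f).card := by
      intro f
      have : (Finset.univ.filter fun i => f i = 0) = f.supportᶜ := by
        ext i; simp
      rw [Fintype.card_subtype, this, Finset.card_compl, card_vals, Fintype.card_fin]
    intro c
    by_cases hc : c = 0
    · subst hc; rw [hzero, hzero, h]
    · rw [hpos c hc, hpos c hc, h]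
  let τ : ∀ c : ℕ, {i // d i = c} ≃ {i // e i = c} := fun c => Fintype.equivOfCardEq (hfib c)
  let σ : Equiv.Perm (Fin n) :=
    (Equiv.sigmaFiberEquiv d).symm.trans
      ((Equiv.sigmaCongrRight τ).trans (Equiv.sigmaFiberEquiv e))
  have hσ : ∀ i, e (σ i) = d i := fun i => (τ (d i) ⟨i, rfl⟩).2
  refine ⟨σ, ?_⟩
  ext j
  obtain ⟨i, rfl⟩ := σ.surjective j
  rw [Finsupp.mapDomain_apply σ.injective, hσ]

/-- Chosen monomial with exponents the parts of `lam`. -/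
noncomputable def expo {n N : ℕ} (h : N ≤ n) (lam : N.Partition) : Fin n →₀ ℕ :=
  (exists_vals (n := n) lam.parts (fun _ ha => lam.parts_pos ha)
    ((card_parts_le lam).trans h)).choose

lemma vals_expo {n N : ℕ} (h : N ≤ n) (lam : N.Partition) : vals (expo h lam) = lam.parts :=
  (exists_vals (n := n) lam.parts (fun _ ha => lam.parts_pos ha)
    ((card_parts_le lam).trans h)).choose_spec

/-- Coefficients at the chosen monomials. -/
noncomputable def coeffMap {n N : ℕ} (h : N ≤ n) : SymHom n N →ₗ[Qα] (N.Partition → Qα) :=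
  LinearMap.pi fun lam => (lcoeff Qα (expo h lam)).comp (SymHom n N).subtype

lemma coeffMap_injective {n N : ℕ} (h : N ≤ n) :
    Function.Injective (coeffMap (n := n) (N := N) h) := by
  rw [← LinearMap.ker_eq_bot, LinearMap.ker_eq_bot']
  rintro ⟨f, hsym, hhom⟩ hf
  have hsym' : f.IsSymmetric := hsym
  have hhom' : f.IsHomogeneous N := hhom
  apply Subtype.ext
  change f = 0
  ext d
  rw [coeff_zero]
  by_contra hd
  have hdeg : d.degree = N := by
    have := hhom' hd
    rwa [Finsupp.degree_eq_weight_one]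
  let mu : N.Partition :=
    { parts := vals d
      parts_pos := by
        intro i hi
        obtain ⟨j, hj, rfl⟩ := Multiset.mem_map.mp hi
        exact Nat.pos_of_ne_zero (Finsupp.mem_support_iff.mp hj)
      parts_sum := by rw [vals_sum, hdeg] }
  obtain ⟨σ, hσ⟩ := exists_perm d (expo h mu) (vals_expo h mu).symm
  have h1 : coeff (expo h mu) f = 0 := congrFun hf mu
  have h2 := coeff_rename_mapDomain σ σ.injective f d
  rw [hsym' σ, hσ, h1] at h2
  exact hd h2.symm

lemma card_eq_finrank {n N : ℕ} (h : N ≤ n) :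
    Fintype.card N.Partition = Module.finrank Qα (SymHom n N) := by
  have : Module.Finite Qα (SymHom n N) := Module.Finite.of_injective _ (coeffMap_injective h)
  apply le_antisymm
  · exact (pElt_linearIndependent h).fintype_card_le_finrank
  · have := LinearMap.finrank_le_finrank_of_injective (coeffMap_injective h)
    simpa using this

/-- The power sum basis `(p_λ)`, `|λ| = N`, of the degree `N` component of `Λ_n ⊗ ℚ(α)`,
for `n ≥ N`. -/
noncomputable def powerSumBasis {n N : ℕ} (h : N ≤ n) :
    Module.Basis N.Partition Qα (SymHom n N) :=
  haveI : Module.Finite Qα (SymHom n N) := Module.Finite.of_injective _ (coeffMap_injective h)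
  Module.Basis.mk (pElt_linearIndependent h)
    ((pElt_linearIndependent h).span_eq_top_of_card_eq_finrank'
      (card_eq_finrank h)).ge

lemma powerSumBasis_apply {n N : ℕ} (h : N ≤ n) (lam : N.Partition) :
    (powerSumBasis h lam : MvPolynomial (Fin n) Qα) = psumPart (Fin n) Qα lam := by
  simp [powerSumBasis, pElt]

/-! ### The scalar product and the Jack polynomials -/

/-- The scalar product with `⟨p_λ, p_μ⟩ = δ_{λμ} z_λ α^{ℓ(λ)}`. -/
noncomputable def jackForm {n N : ℕ} (h : N ≤ n) : LinearMap.BilinForm Qα (SymHom n N) :=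
  Matrix.toBilin (powerSumBasis h) (Matrix.diagonal fun lam => (zee lam : Qα) * α ^ len lam)

lemma jackForm_powerSum {n N : ℕ} (h : N ≤ n) (lam mu : N.Partition) :
    jackForm h (pElt n lam) (pElt n mu) =
      if lam = mu then (zee lam : Qα) * α ^ len lam else 0 := by
  have hb : ∀ nu : N.Partition, pElt n nu = powerSumBasis h nu := fun nu => by
    simp [powerSumBasis]
  rw [hb, hb, jackForm, ← LinearMap.BilinForm.toMatrix_apply (powerSumBasis h),
    LinearMap.BilinForm.toMatrix_toBilin, Matrix.diagonal_apply]

open Classical in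
/-- `(J_λ)`, `|λ| = N`, is the family of Jack polynomials in `n ≥ N` variables and `v` is the
matrix of its coefficients in the basis of symmetric monomials `m_μ`. -/
structure IsJackFamily {n N : ℕ} (h : N ≤ n) (J : N.Partition → SymHom n N)
    (v : N.Partition → N.Partition → Qα) : Prop where
  orthogonal : ∀ lam mu, lam ≠ mu → jackForm h (J lam) (J mu) = 0
  expansion : ∀ lam, (J lam : MvPolynomial (Fin n) Qα) =
    ∑ mu : N.Partition with DomLE mu lam, v lam mu • msymm (Fin n) Qα mu
  normalized : ∀ lam, v lam (onePart N) = (N.factorial : Qα)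

end JackPoly

/-! The proof goes through nonsymmetric Jack polynomials. The Cherednik operators `xi` combine the
Euler operators α x_i ∂_i with divided differences. A joint eigenfunction indexed by a composition η
has eigenvalues α η_i − `rk η i`. Two moves produce such eigenfunctions from the constant 1: the
creation operator x_n f(x_n, x_1, …, x_{n-1}), which raises one entry by 1 and rotates the
composition, and the intertwiner of an adjacent transposition, which exchanges two unequal entries.
Normalizing after each exchange would bring in denominators. The point of `isEig_recStep` is that if
η vanishes beyond position p and its eigenfunction F is invariant in the variables beyond p, then
the whole chain of exchanges collapses, after cancelling common factors, to c Φ_p F + ∑_{i>p} Φ_i F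
with c ∈ ℤ[α], where Φ_i is `creation i`. So `exists_isIntegralJack` gives every composition an
eigenfunction over ℤ[α], with coefficient |η|! at squarefree monomials in the unused variables.

For a partition λ of length m, take F for λ with 1 removed from each part, multiply by x_1⋯x_m, and
sum over the images under injections of the first m indices. No division by a stabilizer order
occurs, and squarefree monomials get coefficient N!. The resulting S_λ is an eigenfunction of `xiSq`
= ∑ ξ_i², which commutes with permutations, and `IsEig.excess_le` makes it triangular for dominance
(`exists_symmetric_eigenfunction`).

It remains to see J_λ = S_λ. In terms of power sums `xiSq` consists of diagonal terms and of pairs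
of mutually adjoint terms joining two power sums or splitting one, so it is self-adjoint
(`psForm_psOp`). The coefficient of α in the eigenvalue of S_λ is −2 ∑ (i−1) λ_i, which separates
comparable partitions, so comparable S_λ are orthogonal. As the form is anisotropic, triangularity,
normalization and this orthogonality already determine the Jack polynomials
(`IsJackFamily.eq_of_triangular`). -/

namespace JackPoly

open MvPolynomial

/-! ### Divided differences. -/

section DividedDifference

variable {n : ℕ} {R : Type*} [CommRing R]

/-- Permutation of the variables, as an algebra homomorphism. -/
noncomputable abbrev perm (σ : Equiv.Perm (Fin n)) :
    MvPolynomial (Fin n) R →ₐ[R] MvPolynomial (Fin n) R := rename σ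

lemma perm_mul (σ τ : Equiv.Perm (Fin n)) (f : MvPolynomial (Fin n) R) :
    perm (σ * τ) f = perm σ (perm τ f) := by
  simp only [perm, rename_rename]; rfl

lemma perm_one (f : MvPolynomial (Fin n) R) : perm 1 f = f := by
  simp [perm]

lemma perm_swap_self (i j : Fin n) (f : MvPolynomial (Fin n) R) :
    perm (Equiv.swap i j) (perm (Equiv.swap i j) f) = f := by
  rw [← perm_mul, Equiv.swap_mul_self, perm_one]

/-- Modulo x_i − x_j the transposition fixes every variable, so the quotient map and its composite
with the transposition agree on generators. -/
lemma X_sub_X_dvd (i j : Fin n) (f : MvPolynomial (Fin n) R) :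
    X i - X j ∣ f - perm (Equiv.swap i j) f := by
  rw [← Ideal.mem_span_singleton, ← Ideal.Quotient.eq]
  have h : (Ideal.Quotient.mkₐ R (Ideal.span {(X i - X j : MvPolynomial (Fin n) R)})) =
      (Ideal.Quotient.mkₐ R (Ideal.span {(X i - X j : MvPolynomial (Fin n) R)})).comp
        (perm (Equiv.swap i j)) := by
    have hij : (Ideal.Quotient.mk (Ideal.span {(X i - X j : MvPolynomial (Fin n) R)})) (X i) =
        (Ideal.Quotient.mk (Ideal.span {(X i - X j : MvPolynomial (Fin n) R)})) (X j) := by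
      rw [Ideal.Quotient.eq]; exact Ideal.mem_span_singleton_self _
    ext k
    simp only [Ideal.Quotient.mkₐ_eq_mk, AlgHom.coe_comp, Function.comp_apply, rename_X]
    rcases eq_or_ne k i with rfl | hi
    · rw [Equiv.swap_apply_left, hij]
    · rcases eq_or_ne k j with rfl | hj
      · rw [Equiv.swap_apply_right, hij]
      · rw [Equiv.swap_apply_of_ne_of_ne hi hj]
  exact DFunLike.congr_fun h f

variable [IsDomain R]

lemma X_sub_X_ne_zero {i j : Fin n} (h : i ≠ j) : (X i - X j : MvPolynomial (Fin n) R) ≠ 0 := by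
  intro h0
  exact h (X_injective (sub_eq_zero.mp h0))

open Classical in
/-- The divided difference `(f - s_{ij} f) / (x_i - x_j)`, and `0` for `i = j`. -/
noncomputable def ddFun (i j : Fin n) (f : MvPolynomial (Fin n) R) : MvPolynomial (Fin n) R :=
  if i = j then 0 else (X_sub_X_dvd i j f).choose

lemma ddFun_spec (i j : Fin n) (f : MvPolynomial (Fin n) R) :
    (X i - X j) * ddFun i j f = f - perm (Equiv.swap i j) f := by
  unfold ddFun
  split_ifs with h
  · subst h
    simp [perm]
  · exact (X_sub_X_dvd i j f).choose_spec.symm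

lemma ddFun_self (i : Fin n) (f : MvPolynomial (Fin n) R) : ddFun i i f = 0 := by
  simp [ddFun]

/-- Cancellation in a domain makes the defining equation a characterization; the later identities
for divided differences are checked after multiplying by x_i − x_j. -/
lemma eq_ddFun {i j : Fin n} (h : i ≠ j) {f g : MvPolynomial (Fin n) R}
    (hg : (X i - X j) * g = f - perm (Equiv.swap i j) f) : g = ddFun i j f :=
  mul_left_cancel₀ (X_sub_X_ne_zero h) (hg.trans (ddFun_spec i j f).symm)

/-- The divided difference `(f - s_{ij} f) / (x_i - x_j)` as a linear map. -/
noncomputable def dd (i j : Fin n) : MvPolynomial (Fin n) R →ₗ[R] MvPolynomial (Fin n) R where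
  toFun := ddFun i j
  map_add' f g := by
    rcases eq_or_ne i j with rfl | h
    · simp [ddFun_self]
    · refine (eq_ddFun h ?_).symm
      rw [mul_add, ddFun_spec, ddFun_spec, map_add]; ring
  map_smul' c f := by
    rcases eq_or_ne i j with rfl | h
    · simp [ddFun_self]
    · refine (eq_ddFun h ?_).symm
      rw [RingHom.id_apply, mul_smul_comm, ddFun_spec, map_smul, smul_sub]

lemma dd_spec (i j : Fin n) (f : MvPolynomial (Fin n) R) :
    (X i - X j) * dd i j f = f - perm (Equiv.swap i j) f := ddFun_spec i j f

@[simp] lemma dd_self (i : Fin n) (f : MvPolynomial (Fin n) R) : dd i i f = 0 := ddFun_self i f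

lemma eq_dd {i j : Fin n} (h : i ≠ j) {f g : MvPolynomial (Fin n) R}
    (hg : (X i - X j) * g = f - perm (Equiv.swap i j) f) : g = dd i j f := eq_ddFun h hg

lemma dd_comm (i j : Fin n) (f : MvPolynomial (Fin n) R) : dd j i f = -dd i j f := by
  rcases eq_or_ne i j with rfl | h
  · simp
  · refine (eq_dd h.symm ?_).symm
    have := dd_spec i j f
    rw [Equiv.swap_comm]
    linear_combination this

lemma dd_of_symm (i j : Fin n) {f : MvPolynomial (Fin n) R}
    (h : perm (Equiv.swap i j) f = f) : dd i j f = 0 := by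
  rcases eq_or_ne i j with rfl | hij
  · simp
  · refine (eq_dd hij ?_).symm
    rw [h]; simp

lemma perm_dd (σ : Equiv.Perm (Fin n)) (i j : Fin n) (f : MvPolynomial (Fin n) R) :
    perm σ (dd i j f) = dd (σ i) (σ j) (perm σ f) := by
  rcases eq_or_ne i j with rfl | h
  · simp
  · refine eq_dd (σ.injective.ne h) ?_
    have := congrArg (perm σ) (dd_spec i j f)
    rw [map_mul, map_sub, map_sub, rename_X, rename_X] at this
    rw [this, ← perm_mul, ← perm_mul, Equiv.swap_apply_apply]
    congr 3
    group

lemma dd_X_mul_of_ne {i j k : Fin n} (hi : k ≠ i) (hj : k ≠ j) (f : MvPolynomial (Fin n) R) :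
    dd i j (X k * f) = X k * dd i j f := by
  rcases eq_or_ne i j with rfl | h
  · simp
  · refine (eq_dd h ?_).symm
    rw [map_mul, rename_X, Equiv.swap_apply_of_ne_of_ne hi hj]
    linear_combination X k * dd_spec i j f

lemma dd_X_right_mul {i j : Fin n} (h : i ≠ j) (f : MvPolynomial (Fin n) R) :
    dd i j (X j * f) = X i * dd i j f - f := by
  refine (eq_dd h ?_).symm
  rw [map_mul, rename_X, Equiv.swap_apply_right]
  linear_combination X i * dd_spec i j f

lemma dd_X_left_mul {i j : Fin n} (h : i ≠ j) (f : MvPolynomial (Fin n) R) :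
    dd i j (X i * f) = X j * dd i j f + f := by
  refine (eq_dd h ?_).symm
  rw [map_mul, rename_X, Equiv.swap_apply_left]
  linear_combination X j * dd_spec i j f

lemma map_dd {S : Type*} [CommRing S] [IsDomain S] (φ : R →+* S) (i j : Fin n)
    (f : MvPolynomial (Fin n) R) : map φ (dd i j f) = dd i j (map φ f) := by
  rcases eq_or_ne i j with rfl | h
  · simp
  · refine eq_dd h ?_
    have := congrArg (map φ) (dd_spec i j f)
    rw [map_mul, map_sub, map_sub, map_X, map_X, map_rename] at this
    exact this

end DividedDifference

/-! ### Euler operators. -/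

section Euler

variable {n : ℕ} {R : Type*} [CommRing R]

/-- The Euler operator `x_i ∂_i`. -/
noncomputable def theta (i : Fin n) : MvPolynomial (Fin n) R →ₗ[R] MvPolynomial (Fin n) R :=
  LinearMap.mulLeft R (X i) ∘ₗ (pderiv i).toLinearMap

lemma theta_apply (i : Fin n) (f : MvPolynomial (Fin n) R) : theta i f = X i * pderiv i f := rfl

lemma theta_mul (i : Fin n) (f g : MvPolynomial (Fin n) R) :
    theta i (f * g) = theta i f * g + f * theta i g := by
  simp only [theta_apply, pderiv_mul]; ring

lemma perm_theta (σ : Equiv.Perm (Fin n)) (i : Fin n) (f : MvPolynomial (Fin n) R) :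
    perm σ (theta i f) = theta (σ i) (perm σ f) := by
  rw [theta_apply, theta_apply, map_mul, rename_X, pderiv_rename σ.injective]

lemma theta_X_self (i : Fin n) : theta i (X i : MvPolynomial (Fin n) R) = X i := by
  simp [theta_apply]

lemma theta_X_of_ne {i j : Fin n} (h : j ≠ i) : theta i (X j : MvPolynomial (Fin n) R) = 0 := by
  simp [theta_apply, pderiv_X_of_ne h]

lemma map_theta {S : Type*} [CommRing S] (φ : R →+* S) (i : Fin n)
    (f : MvPolynomial (Fin n) R) : map φ (theta i f) = theta i (map φ f) := by
  rw [theta_apply, theta_apply, map_mul, map_X, pderiv_map]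

lemma coeff_theta (i : Fin n) (f : MvPolynomial (Fin n) R) (d : Fin n →₀ ℕ) :
    coeff d (theta i f) = d i * coeff d f := by
  induction f using MvPolynomial.induction_on' with
  | monomial u c =>
    rw [theta_apply, X_mul_pderiv_monomial, coeff_smul, coeff_monomial]
    split_ifs with h
    · subst h; simp
    · simp
  | add p q hp hq => rw [map_add, coeff_add, coeff_add, hp, hq]; ring

end Euler

/-! ### Cherednik operators and their commutation with permutations. -/

section Cherednik

variable {n : ℕ} {R : Type*} [CommRing R] [IsDomain R] (a : R)

/-- The Cherednik operators. -/
noncomputable def xi (i : Fin n) : MvPolynomial (Fin n) R →ₗ[R] MvPolynomial (Fin n) R :=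
  -- Indices start at 0, so the constant 1 has eigenvalue −i. The factor x_max(i,j) is the
  -- asymmetric choice that yields the relation `perm_swap_xi`.
  a • theta i + ∑ j, LinearMap.mulLeft R (X (max i j)) ∘ₗ dd i j - ((i : ℕ) : R) • LinearMap.id

lemma xi_apply (i : Fin n) (f : MvPolynomial (Fin n) R) :
    xi a i f = C a * theta i f + ∑ j, X (max i j) * dd i j f - ((i : ℕ) : MvPolynomial (Fin n) R) * f := by
  simp [xi, smul_eq_C_mul]

lemma map_xi {S : Type*} [CommRing S] [IsDomain S] (φ : R →+* S) (i : Fin n)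
    (f : MvPolynomial (Fin n) R) : map φ (xi a i f) = xi (φ a) i (map φ f) := by
  simp [xi_apply, map_theta, map_dd]

lemma perm_xi (σ : Equiv.Perm (Fin n)) (i : Fin n) (f : MvPolynomial (Fin n) R) :
    perm σ (xi a i f) = C a * theta (σ i) (perm σ f)
      + ∑ j, X (σ (max i j)) * dd (σ i) (σ j) (perm σ f) - ((i : ℕ) : MvPolynomial (Fin n) R) * perm σ f := by
  rw [xi_apply, map_sub, map_add, map_mul, map_mul, rename_C, perm_theta, map_sum, map_natCast]
  simp only [map_mul, perm_dd, rename_X]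

/-- Since k and k' are adjacent, they lie on the same side of any other index i, so the swap is
compatible with taking the maximum with i. -/
lemma perm_swap_xi_of_ne {k k' : Fin n} (hk : (k' : ℕ) = k + 1) {i : Fin n} (hi : i ≠ k)
    (hi' : i ≠ k') (f : MvPolynomial (Fin n) R) :
    perm (Equiv.swap k k') (xi a i f) = xi a i (perm (Equiv.swap k k') f) := by
  rw [perm_xi, xi_apply, Equiv.swap_apply_of_ne_of_ne hi hi']
  congr 2
  refine Fintype.sum_equiv (Equiv.swap k k') _ _ fun j => ?_
  congr 2
  have h1 : (i : ℕ) ≠ k := fun h => hi (Fin.ext h)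
  have h2 : (i : ℕ) ≠ k' := fun h => hi' (Fin.ext h)
  rcases eq_or_ne j k with rfl | hj
  · rw [Equiv.swap_apply_left]
    rcases lt_or_ge i j with h | h
    · have : i ≤ k' := by rw [Fin.le_def]; rw [Fin.lt_def] at h; omega
      rw [max_eq_right h.le, max_eq_right this, Equiv.swap_apply_left]
    · have : k' ≤ i := by rw [Fin.le_def] at *; omega
      rw [max_eq_left h, max_eq_left this, Equiv.swap_apply_of_ne_of_ne hi hi']
  · rcases eq_or_ne j k' with rfl | hj'
    · rw [Equiv.swap_apply_right]
      rcases lt_or_ge i j with h | h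
      · have : i ≤ k := by rw [Fin.le_def]; rw [Fin.lt_def] at h; omega
        rw [max_eq_right h.le, max_eq_right this, Equiv.swap_apply_right]
      · have : k ≤ i := by rw [Fin.le_def] at *; omega
        rw [max_eq_left h, max_eq_left this, Equiv.swap_apply_of_ne_of_ne hi hi']
    · rw [Equiv.swap_apply_of_ne_of_ne hj hj']
      rcases max_choice i j with h | h <;> rw [h]
      · rw [Equiv.swap_apply_of_ne_of_ne hi hi']
      · rw [Equiv.swap_apply_of_ne_of_ne hj hj']

/-- The degenerate affine Hecke relation s ξ_k = ξ_{k+1} s + 1. After relabelling, the sums differ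
only in the term for the pair {k, k'}, where x_k stands in place of x_k'; this contributes f − s f,
and the constants k and k + 1 supply the missing s f. -/
lemma perm_swap_xi {k k' : Fin n} (hk : (k' : ℕ) = k + 1) (f : MvPolynomial (Fin n) R) :
    perm (Equiv.swap k k') (xi a k f) = xi a k' (perm (Equiv.swap k k') f) + f := by
  have hne : k' ≠ k := fun h => by rw [h] at hk; omega
  rw [perm_xi, xi_apply, Equiv.swap_apply_left]
  set g := perm (Equiv.swap k k') f with hg
  have hgf : perm (Equiv.swap k' k) g = f := by
    rw [Equiv.swap_comm, hg, perm_swap_self]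
  have key : ∑ j, X ((Equiv.swap k k') (max k j)) * dd k' ((Equiv.swap k k') j) g
      = ∑ j, (X (max k' j) * dd k' j g + if j = k then (f - g) else 0) := by
    refine Fintype.sum_equiv (Equiv.swap k k') _ _ fun j => ?_
    rcases eq_or_ne j k with rfl | hj
    · rw [Equiv.swap_apply_left]; simp [hne]
    · rcases eq_or_ne j k' with rfl | hj'
      · have h1 : k ≤ j := by rw [Fin.le_def]; omega
        rw [max_eq_right h1, Equiv.swap_apply_right, max_eq_left h1, if_pos rfl]
        have := dd_spec j k g
        rw [hgf] at this
        linear_combination -this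
      · rw [Equiv.swap_apply_of_ne_of_ne hj hj', if_neg hj, add_zero]
        congr 2
        have h1 : (j : ℕ) ≠ k := fun h => hj (Fin.ext h)
        have h2 : (j : ℕ) ≠ k' := fun h => hj' (Fin.ext h)
        rcases lt_or_ge j k with h | h
        · have : j ≤ k' := by rw [Fin.le_def]; rw [Fin.lt_def] at h; omega
          rw [max_eq_left h.le, max_eq_left this, Equiv.swap_apply_left]
        · have : k' ≤ j := by rw [Fin.le_def] at *; omega
          rw [max_eq_right h, max_eq_right this, Equiv.swap_apply_of_ne_of_ne hj hj']
  rw [key, Finset.sum_add_distrib, hk]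
  simp
  ring

lemma perm_swap_xi' {k k' : Fin n} (hk : (k' : ℕ) = k + 1) (f : MvPolynomial (Fin n) R) :
    perm (Equiv.swap k k') (xi a k' f) = xi a k (perm (Equiv.swap k k') f) - f := by
  have := congrArg (perm (Equiv.swap k k')) (perm_swap_xi a hk (perm (Equiv.swap k k') f))
  rw [map_add, perm_swap_self, perm_swap_self] at this
  rw [this]; ring

/-- The sum of the squares of the Cherednik operators. -/
noncomputable def xiSq : MvPolynomial (Fin n) R →ₗ[R] MvPolynomial (Fin n) R :=
  ∑ i, xi a i ∘ₗ xi a i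

lemma xiSq_apply (f : MvPolynomial (Fin n) R) : xiSq a f = ∑ i, xi a i (xi a i f) := by
  simp [xiSq]

lemma map_xiSq {S : Type*} [CommRing S] [IsDomain S] (φ : R →+* S)
    (f : MvPolynomial (Fin n) R) : map φ (xiSq a f) = xiSq (φ a) (map φ f) := by
  simp [xiSq_apply, map_xi]

/-- Moving s past ξ_k² and ξ_{k+1}² produces corrections ξ_k + ξ_{k+1} with opposite signs, so they
cancel in the sum. -/
lemma perm_swap_xiSq {k k' : Fin n} (hk : (k' : ℕ) = k + 1) (f : MvPolynomial (Fin n) R) :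
    perm (Equiv.swap k k') (xiSq a f) = xiSq a (perm (Equiv.swap k k') f) := by
  have hne : k ≠ k' := fun h => by rw [h] at hk; omega
  have split : ∀ F : Fin n → MvPolynomial (Fin n) R,
      ∑ i, F i = (F k + F k') + ∑ i ∈ ({k, k'} : Finset (Fin n))ᶜ, F i := fun F => by
    rw [← Finset.sum_pair hne, Finset.sum_add_sum_compl]
  rw [xiSq_apply, xiSq_apply, split, split, map_add, map_add, map_sum]
  congr 1
  · rw [perm_swap_xi a hk, perm_swap_xi a hk, perm_swap_xi' a hk, perm_swap_xi' a hk, map_add,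
      map_sub]
    ring
  · refine Finset.sum_congr rfl fun i hi => ?_
    simp only [Finset.mem_compl, Finset.mem_insert, Finset.mem_singleton, not_or] at hi
    rw [perm_swap_xi_of_ne a hk hi.1 hi.2, perm_swap_xi_of_ne a hk hi.1 hi.2]

lemma perm_xiSq (σ : Equiv.Perm (Fin n)) (f : MvPolynomial (Fin n) R) :
    perm σ (xiSq a f) = xiSq a (perm σ f) := by
  cases n with
  | zero => rw [Subsingleton.elim σ 1, perm_one, perm_one]
  | succ n =>
    have hσ : σ ∈ Submonoid.closure (Set.range fun i : Fin n ↦ Equiv.swap i.castSucc i.succ) := by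
      rw [Equiv.Perm.mclosure_swap_castSucc_succ]; trivial
    induction hσ using Submonoid.closure_induction generalizing f with
    | mem x hx =>
      obtain ⟨i, rfl⟩ := hx
      exact perm_swap_xiSq a (by simp) f
    | one => rw [perm_one, perm_one]
    | mul x y _ _ hx hy => rw [perm_mul, perm_mul, hy, hx]

end Cherednik

/-! ### The creation operators. -/

section Creation

variable {n : ℕ} {R : Type*} [CommRing R]

/-- The operators `f ↦ x_i f(x_i, x_0, …, x_{i-1}, x_{i+1}, …)`. -/
noncomputable def creation (i : Fin (n + 1)) :
    MvPolynomial (Fin (n + 1)) R →ₗ[R] MvPolynomial (Fin (n + 1)) R :=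
  LinearMap.mulLeft R (X i) ∘ₗ (perm i.cycleRange.symm).toLinearMap

lemma creation_apply (i : Fin (n + 1)) (f : MvPolynomial (Fin (n + 1)) R) :
    creation i f = X i * perm i.cycleRange.symm f := rfl

lemma cycleRange_last_symm_succ (i : Fin n) :
    (Fin.last n).cycleRange.symm i.succ = i.castSucc := by
  rw [Fin.cycleRange_symm_succ, Fin.succAbove_last]

variable [IsDomain R] (a : R)

/-- Rotation carries each pair of indices to a pair in the same order except those involving 0,
which becomes the last index. There the extra term −x_last g, from moving x_last through the divided
difference, accounts for the change of the constant from i + 1 to i. -/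
lemma xi_castSucc_creation (i : Fin n) (f : MvPolynomial (Fin (n + 1)) R) :
    xi a i.castSucc (creation (Fin.last n) f) = creation (Fin.last n) (xi a i.succ f) := by
  rw [creation_apply, creation_apply, perm_xi, xi_apply, cycleRange_last_symm_succ]
  set g := perm (Fin.last n).cycleRange.symm f
  have hne : i.castSucc ≠ Fin.last n := (Fin.castSucc_lt_last i).ne
  rw [Fin.sum_univ_castSucc, Fin.sum_univ_succ, Fin.cycleRange_symm_zero,
    max_eq_left (Fin.zero_le _), cycleRange_last_symm_succ, max_eq_right (Fin.le_last _),
    dd_X_right_mul hne, theta_mul, theta_X_of_ne hne.symm]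
  have : ∀ j : Fin n, X (max i.castSucc j.castSucc) * dd i.castSucc j.castSucc (X (Fin.last n) * g)
      = X (Fin.last n) * (X ((Fin.last n).cycleRange.symm (max i.succ j.succ)) *
        dd i.castSucc ((Fin.last n).cycleRange.symm j.succ) g) := fun j => by
    have h1 : (Fin.last n).cycleRange.symm (max i.succ j.succ) = max i.castSucc j.castSucc := by
      rcases le_total i j with h | h
      · rw [max_eq_right (Fin.succ_le_succ_iff.mpr h), cycleRange_last_symm_succ,
          max_eq_right (Fin.castSucc_le_castSucc_iff.mpr h)]
      · rw [max_eq_left (Fin.succ_le_succ_iff.mpr h), cycleRange_last_symm_succ,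
          max_eq_left (Fin.castSucc_le_castSucc_iff.mpr h)]
    rw [h1, cycleRange_last_symm_succ, dd_X_mul_of_ne hne.symm (Fin.castSucc_lt_last j).ne']
    ring
  rw [Finset.sum_congr rfl fun j _ => this j, ← Finset.mul_sum]
  simp only [Fin.val_castSucc, Fin.val_succ]
  push_cast
  ring

/-- The Euler operator applied to the new factor x_last gives the summand a; the n divided
differences each contribute one copy of the function, cancelling the constant n of the last
operator. -/
lemma xi_last_creation (f : MvPolynomial (Fin (n + 1)) R) :
    xi a (Fin.last n) (creation (Fin.last n) f) =
      creation (Fin.last n) (xi a 0 f) + C a * creation (Fin.last n) f := by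
  rw [creation_apply, creation_apply, perm_xi, xi_apply, Fin.cycleRange_symm_zero]
  set g := perm (Fin.last n).cycleRange.symm f
  rw [Fin.sum_univ_castSucc, Fin.sum_univ_succ, Fin.cycleRange_symm_zero, dd_self, dd_self,
    theta_mul, theta_X_self]
  have : ∀ j : Fin n, X (max (Fin.last n) j.castSucc) * dd (Fin.last n) j.castSucc
      (X (Fin.last n) * g) = X (Fin.last n) * (X ((Fin.last n).cycleRange.symm (max 0 j.succ)) *
        dd (Fin.last n) ((Fin.last n).cycleRange.symm j.succ) g) + X (Fin.last n) * g := fun j => by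
    rw [max_eq_left (Fin.le_last _), max_eq_right (Fin.zero_le _), cycleRange_last_symm_succ,
      dd_X_left_mul (Fin.castSucc_lt_last j).ne']
    ring
  rw [Finset.sum_congr rfl fun j _ => this j, Finset.sum_add_distrib, ← Finset.mul_sum]
  simp
  ring

end Creation

/-! ### Ranks of the entries of a composition. -/

section Rank

variable {n : ℕ}

/-- The number of entries which precede the `i`-th one when the entries of `η` are sorted
decreasingly, ties being broken by position. -/
def rk (η : Fin n → ℕ) (i : Fin n) : ℕ :=
  (Finset.univ.filter fun j => η i < η j ∨ (η j = η i ∧ j < i)).card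

lemma rk_congr {η η' : Fin n → ℕ} (σ : Equiv.Perm (Fin n)) (i : Fin n)
    (h : ∀ j, (η' (σ i) < η' (σ j) ∨ (η' (σ j) = η' (σ i) ∧ σ j < σ i)) ↔
      (η i < η j ∨ (η j = η i ∧ j < i))) : rk η' (σ i) = rk η i := by
  unfold rk
  refine (Finset.card_equiv σ fun j => ?_).symm
  simp only [Finset.mem_filter, Finset.mem_univ, true_and]
  exact (h j).symm

/-- Positions matter only between equal entries, and an adjacent swap changes the relative position
of the two swapped entries only, which are unequal. -/
lemma rk_swap {k k' : Fin n} (hk : (k' : ℕ) = k + 1) {η : Fin n → ℕ} (hη : η k ≠ η k')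
    (i : Fin n) : rk (η ∘ Equiv.swap k k') (Equiv.swap k k' i) = rk η i := by
  refine rk_congr _ _ fun j => ?_
  simp only [Function.comp_apply, Equiv.swap_apply_self]
  have hne : k ≠ k' := fun h => hη (by rw [h])
  by_cases hik : i = k
  · subst hik
    by_cases hjk : j = k'
    · subst hjk; simp [hη.symm]
    · by_cases hji : j = i
      · subst hji; simp
      · rw [Equiv.swap_apply_left, Equiv.swap_apply_of_ne_of_ne hji hjk]
        have : (j : ℕ) ≠ i := fun h => hji (Fin.ext h)
        simp only [Fin.lt_def]; omega
  · by_cases hik' : i = k'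
    · subst hik'
      by_cases hjk : j = k
      · subst hjk; simp [hη]
      · by_cases hji : j = i
        · subst hji; simp
        · rw [Equiv.swap_apply_right, Equiv.swap_apply_of_ne_of_ne hjk hji]
          have : (j : ℕ) ≠ i := fun h => hji (Fin.ext h)
          simp only [Fin.lt_def]; omega
    · rw [Equiv.swap_apply_of_ne_of_ne hik hik']
      have h1 : (i : ℕ) ≠ k := fun h => hik (Fin.ext h)
      have h2 : (i : ℕ) ≠ k' := fun h => hik' (Fin.ext h)
      by_cases hjk : j = k
      · subst hjk; rw [Equiv.swap_apply_left]; simp only [Fin.lt_def]; omega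
      · by_cases hjk' : j = k'
        · subst hjk'; rw [Equiv.swap_apply_right]; simp only [Fin.lt_def]; omega
        · rw [Equiv.swap_apply_of_ne_of_ne hjk hjk']

/-- The composition `(η_1, …, η_k, η_0 + 1, η_{k+1}, …)`. -/
def shift (k : Fin (n + 1)) (η : Fin (n + 1) → ℕ) (i : Fin (n + 1)) : ℕ :=
  η (k.cycleRange i) + if i = k then 1 else 0

lemma shift_last (η : Fin (n + 1) → ℕ) : shift (Fin.last n) η (Fin.last n) = η 0 + 1 := by
  simp [shift]

lemma shift_castSucc (η : Fin (n + 1) → ℕ) (i : Fin n) : shift (Fin.last n) η i.castSucc = η i.succ := by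
  simp [shift, (Fin.castSucc_lt_last i).ne]

/-- The first entry precedes another one when it is at least as large. Moved to the last place it
must be strictly larger, and the added 1 compensates exactly. -/
lemma rk_shift (η : Fin (n + 1) → ℕ) (i : Fin (n + 1)) :
    rk (shift (Fin.last n) η) ((Fin.last n).cycleRange.symm i) = rk η i := by
  refine rk_congr _ _ fun j => ?_
  refine Fin.cases ?_ (fun i => ?_) i <;> refine Fin.cases ?_ (fun j => ?_) j
  · simp
  · rw [Fin.cycleRange_symm_zero, cycleRange_last_symm_succ, shift_castSucc, shift_last]
    simp only [Fin.lt_def, Fin.val_castSucc, Fin.val_last, Fin.val_succ, Fin.val_zero]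
    have := j.isLt
    omega
  · rw [Fin.cycleRange_symm_zero, cycleRange_last_symm_succ, shift_castSucc, shift_last]
    simp only [Fin.lt_def, Fin.val_castSucc, Fin.val_last, Fin.val_succ, Fin.val_zero]
    have := i.isLt
    omega
  · rw [cycleRange_last_symm_succ, cycleRange_last_symm_succ, shift_castSucc, shift_castSucc]
    simp

end Rank

/-! ### Joint eigenfunctions: creation and intertwining. -/

section Eigen

variable {n : ℕ} {R : Type*} [CommRing R] [IsDomain R] (a : R)

/-- `f` is a joint eigenfunction of the Cherednik operators, with the eigenvalues of the
nonsymmetric Jack polynomial of index `η`. -/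
def IsEig (η : Fin n → ℕ) (f : MvPolynomial (Fin n) R) : Prop :=
  ∀ i, xi a i f = C (a * η i - rk η i) * f

variable {a}

lemma xi_C_mul (i : Fin n) (c : R) (f : MvPolynomial (Fin n) R) :
    xi a i (C c * f) = C c * xi a i f := by
  rw [← smul_eq_C_mul, map_smul, smul_eq_C_mul]

lemma IsEig.const_mul {η : Fin n → ℕ} {f : MvPolynomial (Fin n) R} (h : IsEig a η f) (c : R) :
    IsEig a η (C c * f) := fun i => by rw [xi_C_mul, h i]; ring

lemma IsEig.of_const_mul {η : Fin n → ℕ} {f : MvPolynomial (Fin n) R} {c : R} (hc : c ≠ 0)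
    (h : IsEig a η (C c * f)) : IsEig a η f := fun i => by
  have := h i
  rw [xi_C_mul] at this
  refine mul_left_cancel₀ (a := C c) (by rwa [Ne, C_eq_zero]) ?_
  rw [this]; ring

lemma IsEig.creation_last {η : Fin (n + 1) → ℕ} {f : MvPolynomial (Fin (n + 1)) R}
    (h : IsEig a η f) : IsEig a (shift (Fin.last n) η) (creation (Fin.last n) f) := by
  intro i
  have hC : ∀ c : R, creation (Fin.last n) (C c * f) = C c * creation (Fin.last n) f :=
    fun c => by rw [← smul_eq_C_mul, map_smul, smul_eq_C_mul]
  refine Fin.lastCases ?_ (fun i => ?_) i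
  · have hr := rk_shift η 0
    rw [Fin.cycleRange_symm_zero] at hr
    rw [xi_last_creation, h 0, shift_last, hr, hC, ← add_mul, ← C_add]
    congr 2
    push_cast; ring
  · have hr := rk_shift η i.succ
    rw [cycleRange_last_symm_succ] at hr
    rw [xi_castSucc_creation, h, shift_castSucc, hr, hC]

/-- By `perm_swap_xi` the operators ξ_k and ξ_k' act triangularly on the span of f and s f, and this
combination diagonalizes them. The eigenvalue difference appears as a factor rather than a divisor,
so no denominators arise. -/
lemma IsEig.intertwine {k k' : Fin n} (hk : (k' : ℕ) = k + 1) {η : Fin n → ℕ}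
    (hη : η k ≠ η k') {f : MvPolynomial (Fin n) R} (h : IsEig a η f) :
    IsEig a (η ∘ Equiv.swap k k')
      (C ((a * η k' - rk η k') - (a * η k - rk η k)) * perm (Equiv.swap k k') f + f) := by
  have hne : k ≠ k' := fun h => hη (by rw [h])
  have hC : ∀ c : R, perm (Equiv.swap k k') (C c * f) = C c * perm (Equiv.swap k k') f :=
    fun c => by rw [map_mul, rename_C]
  intro i
  obtain ⟨i, rfl⟩ := (Equiv.swap k k').surjective i
  rw [rk_swap hk hη, Function.comp_apply, Equiv.swap_apply_self, map_add, xi_C_mul]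
  rcases eq_or_ne i k with rfl | hik
  · have h2 := perm_swap_xi a hk f
    rw [h, hC] at h2
    rw [Equiv.swap_apply_left, h]
    simp only [C_sub, C_mul] at h2 ⊢
    linear_combination -(C a * (C (η k' : R)) - C (rk η k' : R)
      - (C a * C (η i : R) - C (rk η i : R))) * h2
  · rcases eq_or_ne i k' with rfl | hik'
    · have h2 := perm_swap_xi' a hk f
      rw [h, hC] at h2
      rw [Equiv.swap_apply_right, h]
      simp only [C_sub, C_mul] at h2 ⊢
      linear_combination -(C a * (C (η i : R)) - C (rk η i : R)
        - (C a * C (η k : R) - C (rk η k : R))) * h2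
    · rw [Equiv.swap_apply_of_ne_of_ne hik hik', ← perm_swap_xi_of_ne a hk hik hik', h, hC]
      ring

lemma IsEig.xiSq_eq {η : Fin n → ℕ} {f : MvPolynomial (Fin n) R} (h : IsEig a η f) :
    xiSq a f = C (∑ i, (a * η i - rk η i) ^ 2) * f := by
  rw [xiSq_apply, map_sum, Finset.sum_mul]
  refine Finset.sum_congr rfl fun i _ => ?_
  rw [h i, xi_C_mul, h i, C_pow]; ring

end Eigen

/-! ### Creation operators under permutations, and their coefficients. -/

section CreationPerm

variable {n : ℕ} {R : Type*} [CommRing R]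

lemma coeff_perm (σ : Equiv.Perm (Fin n)) (d : Fin n →₀ ℕ) (f : MvPolynomial (Fin n) R) :
    coeff d (perm σ f) = coeff (Finsupp.equivMapDomain σ.symm d) f := by
  have h := coeff_rename_mapDomain σ σ.injective f (Finsupp.equivMapDomain σ.symm d)
  rw [← Finsupp.equivMapDomain_eq_mapDomain, ← Finsupp.equivMapDomain_trans] at h
  simpa using h

/-- Conjugating σ by the cycles attached to i and σ i gives a permutation that fixes 0, …, p, which
F ignores: the cycles send index 0 to i and to σ i, and agree on the indices 1, …, p. -/
lemma perm_creation {p : Fin (n + 1)} {f : MvPolynomial (Fin (n + 1)) R}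
    (hf : ∀ τ : Equiv.Perm (Fin (n + 1)), (∀ j ≤ p, τ j = j) → perm τ f = f)
    {σ : Equiv.Perm (Fin (n + 1))} (hσ : ∀ j < p, σ j = j) {i : Fin (n + 1)} (hi : p ≤ i) :
    perm σ (creation i f) = creation (σ i) f := by
  have hσi : p ≤ σ i := by
    by_contra! h
    have := σ.injective (hσ _ h)
    rw [this] at h
    exact absurd h (not_lt.mpr hi)
  have hcast : ∀ (k : Fin (n + 1)) (j : Fin n), p ≤ k → j.succ ≤ p →
      k.cycleRange.symm j.succ = j.castSucc := fun k j hk hj => by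
    rw [Fin.cycleRange_symm_succ, Fin.succAbove_of_castSucc_lt]
    exact (Fin.castSucc_lt_succ.trans_le hj).trans_le hk
  have h := hf ((σ i).cycleRange * σ * i.cycleRange.symm) fun j hj => by
    refine Fin.cases (fun _ => ?_) (fun j hj => ?_) j hj
    · simp
    · simp only [Equiv.Perm.mul_apply]
      rw [hcast i j hi hj, hσ _ (Fin.castSucc_lt_succ.trans_le hj), ← hcast (σ i) j hσi hj,
        Equiv.apply_symm_apply]
  rw [creation_apply, creation_apply, map_mul, rename_X]
  congr 1
  conv_rhs => rw [← h]
  rw [← perm_mul, ← perm_mul]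
  congr 1
  rw [← mul_assoc, ← mul_assoc]
  have : (Equiv.symm (σ i).cycleRange : Equiv.Perm _) * (σ i).cycleRange = 1 := by
    ext; simp
  rw [this, one_mul]

lemma creation_isHomogeneous {f : MvPolynomial (Fin (n + 1)) R} {N : ℕ} (hf : f.IsHomogeneous N)
    (i : Fin (n + 1)) : (creation i f).IsHomogeneous (N + 1) := by
  have := (isHomogeneous_X R i).mul (hf.rename_isHomogeneous (f := i.cycleRange.symm))
  rwa [add_comm 1 N] at this

lemma coeff_creation_of_eq_zero (i : Fin (n + 1)) (f : MvPolynomial (Fin (n + 1)) R)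
    {d : Fin (n + 1) →₀ ℕ} (hd : d i = 0) : coeff d (creation i f) = 0 := by
  rw [creation_apply, mul_comm, coeff_mul_X', if_neg (by simpa using hd)]

lemma coeff_creation (i : Fin (n + 1)) (f : MvPolynomial (Fin (n + 1)) R)
    {d : Fin (n + 1) →₀ ℕ} (hd : d i ≠ 0) : coeff d (creation i f) =
      coeff (Finsupp.equivMapDomain i.cycleRange (d - Finsupp.single i 1)) f := by
  rw [creation_apply, mul_comm, coeff_mul_X', if_pos (by simpa using hd), coeff_perm,
    Equiv.symm_symm]

end CreationPerm

/-! ### The index of a created polynomial. -/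

section Shift

variable {n : ℕ}

/-- Makes shifts to neighbouring positions differ by an adjacent swap, as needed to descend from the
last position by intertwiners. -/
lemma cycleRange_castSucc (k : Fin n) :
    k.castSucc.cycleRange = k.succ.cycleRange * Equiv.swap k.castSucc k.succ := by
  have : k.castSucc.cycleRange.symm = Equiv.swap k.castSucc k.succ * k.succ.cycleRange.symm := by
    ext j : 1
    refine Fin.cases ?_ (fun j => ?_) j
    · simp
    · rw [Equiv.Perm.mul_apply, Fin.cycleRange_symm_succ, Fin.cycleRange_symm_succ]
      rcases lt_trichotomy j k with h | rfl | h
      · rw [Fin.succAbove_of_castSucc_lt _ _ (Fin.castSucc_lt_castSucc_iff.mpr h),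
          Fin.succAbove_of_castSucc_lt _ _
            ((Fin.castSucc_lt_castSucc_iff.mpr h).trans Fin.castSucc_lt_succ),
          Equiv.swap_apply_of_ne_of_ne]
        · exact (Fin.castSucc_lt_castSucc_iff.mpr h).ne
        · exact ((Fin.castSucc_lt_castSucc_iff.mpr h).trans Fin.castSucc_lt_succ).ne
      · rw [Fin.succAbove_castSucc_self, Fin.succAbove_succ_self, Equiv.swap_apply_left]
      · rw [Fin.succAbove_of_lt_succ _ _
            ((Fin.castSucc_lt_succ).trans (Fin.succ_lt_succ_iff.mpr h)),
          Fin.succAbove_of_lt_succ _ _ (Fin.succ_lt_succ_iff.mpr h),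
          Equiv.swap_apply_of_ne_of_ne]
        · exact ((Fin.castSucc_lt_succ).trans (Fin.succ_lt_succ_iff.mpr h)).ne'
        · exact (Fin.succ_lt_succ_iff.mpr h).ne'
  ext j : 1
  have h2 := congrArg (fun τ => τ (k.castSucc.cycleRange j)) this
  simp only [Equiv.symm_apply_apply, Equiv.Perm.mul_apply] at h2
  rw [Equiv.Perm.mul_apply]
  conv_rhs => rw [h2, Equiv.swap_apply_self, Equiv.apply_symm_apply]

lemma shift_self (k : Fin (n + 1)) (η : Fin (n + 1) → ℕ) : shift k η k = η 0 + 1 := by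
  simp [shift]

lemma shift_of_lt {k j : Fin (n + 1)} (h : k < j) (η : Fin (n + 1) → ℕ) :
    shift k η j = η j := by
  simp [shift, Fin.cycleRange_of_gt h, h.ne']

lemma shift_succ_castSucc (k : Fin n) (η : Fin (n + 1) → ℕ) :
    shift k.succ η k.castSucc = η k.succ := by
  simp [shift, Fin.castSucc_lt_succ.ne, Fin.cycleRange_of_lt (Fin.castSucc_lt_succ)]

lemma shift_castSucc_eq (k : Fin n) (η : Fin (n + 1) → ℕ) :
    shift k.castSucc η = shift k.succ η ∘ Equiv.swap k.castSucc k.succ := by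
  ext j
  simp only [shift, Function.comp_apply, cycleRange_castSucc, Equiv.Perm.mul_apply,
    Equiv.swap_apply_eq_iff, Equiv.swap_apply_right]

/-- Every composition with a nonzero entry at k is a shift; this inverts the recursion on
compositions. -/
lemma shift_pred (k : Fin (n + 1)) {η : Fin (n + 1) → ℕ} (h : η k ≠ 0) :
    shift k (fun i => η (k.cycleRange.symm i) - if i = 0 then 1 else 0) = η := by
  ext j
  simp only [shift, Equiv.symm_apply_apply]
  rcases eq_or_ne j k with rfl | hj
  · simp; omega
  · have : k.cycleRange j ≠ 0 := fun h0 => hj (by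
      rw [← Fin.cycleRange_self k] at h0; exact k.cycleRange.injective h0)
    simp [hj, this]

lemma sum_shift (k : Fin (n + 1)) (η : Fin (n + 1) → ℕ) :
    ∑ i, shift k η i = ∑ i, η i + 1 := by
  simp only [shift, Finset.sum_add_distrib, Finset.sum_ite_eq', Finset.mem_univ, if_true]
  rw [Equiv.sum_comp k.cycleRange η]

/-- Creation at the last place preserves the rank. Each move downwards swaps the positive entry η_0
+ 1 with a zero entry, which preserves it as well. -/
lemma rk_shift_self {η : Fin (n + 1) → ℕ} (p k : Fin (n + 1)) (hη : ∀ j, p < j → η j = 0)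
    (hk : p ≤ k) : rk (shift k η) k = rk η 0 := by
  induction k using Fin.reverseInduction with
  | last =>
    have := rk_shift η 0
    rwa [Fin.cycleRange_symm_zero] at this
  | cast k ih =>
    have hlt : p < k.succ := hk.trans_lt Fin.castSucc_lt_succ
    have hne : shift k.succ η k.castSucc ≠ shift k.succ η k.succ := by
      rw [shift_self, shift_succ_castSucc, hη _ hlt]; omega
    have := rk_swap (by simp) hne k.succ
    rw [Equiv.swap_apply_right, ← shift_castSucc_eq] at this
    rw [this, ih hlt.le]

/-- The entry at k is zero, the entry just after it is positive, and all later ones vanish. So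
exactly the k earlier positions and the position k + 1 precede it. -/
lemma rk_shift_succ_castSucc {η : Fin (n + 1) → ℕ} (k : Fin n)
    (hη : ∀ j, k.castSucc < j → η j = 0) : rk (shift k.succ η) k.castSucc = k + 1 := by
  have h0 : shift k.succ η k.castSucc = 0 := by
    rw [shift_succ_castSucc, hη _ Fin.castSucc_lt_succ]
  unfold rk
  have : (Finset.univ.filter fun j => shift k.succ η k.castSucc < shift k.succ η j ∨
      (shift k.succ η j = shift k.succ η k.castSucc ∧ j < k.castSucc)) =
      (Finset.Iic k.succ).erase k.castSucc := by
    ext j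
    simp only [Finset.mem_filter, Finset.mem_univ, true_and, h0, Finset.mem_erase,
      Finset.mem_Iic]
    rcases lt_trichotomy j k.castSucc with h | rfl | h
    · have h' : j ≤ k.succ := h.le.trans Fin.castSucc_lt_succ.le
      simp only [h, h', h.ne, and_true, ne_eq, not_false_eq_true, iff_true]
      omega
    · simp [h0]
    · rcases eq_or_ne j k.succ with rfl | hj
      · simp [shift_self, Fin.castSucc_lt_succ.ne']
      · have hlt : k.succ < j := lt_of_le_of_ne (by
          rw [Fin.le_def]; rw [Fin.lt_def] at h; simp at *; omega) hj.symm
        rw [shift_of_lt hlt, hη _ h]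
        simp [not_lt.mpr h.le, not_le.mpr hlt]
  rw [this, Finset.card_erase_of_mem (by simp [Fin.castSucc_lt_succ.le]), Fin.card_Iic]
  simp

end Shift

/-! ### The integral recursion for nonsymmetric Jack polynomials. -/

section Recursion

variable {n : ℕ}

/-- The integral nonsymmetric Jack polynomial attached to a composition `η` vanishing from
position `m` on. -/
structure IsIntegralJack (η : Fin (n + 1) → ℕ) (m : ℕ)
    (F : MvPolynomial (Fin (n + 1)) (Polynomial ℤ)) : Prop where
  eig : IsEig Polynomial.X η F
  symm : ∀ σ : Equiv.Perm (Fin (n + 1)), (∀ j : Fin (n + 1), (j : ℕ) < m → σ j = j) →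
    perm σ F = F
  homog : F.IsHomogeneous (∑ i, η i)
  coeff_eq : ∀ d : Fin (n + 1) →₀ ℕ, (∀ i, d i ≤ 1) → (∀ i : Fin (n + 1), (i : ℕ) < m → d i = 0) →
    ∑ i, d i = ∑ i, η i → coeff d F = ((∑ i, η i).factorial : Polynomial ℤ)

lemma X_mul_sub_ne_zero (c : ℕ) (d : ℤ) (hc : c ≠ 0) :
    (Polynomial.X * (c : Polynomial ℤ) + (d : Polynomial ℤ)) ≠ 0 := by
  intro h
  have := congrArg (fun q => Polynomial.coeff q 1) h
  simp only [Polynomial.coeff_add, Polynomial.coeff_X_mul, Polynomial.coeff_zero] at this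
  rw [← Polynomial.C_eq_natCast, Polynomial.coeff_C_zero, ← Polynomial.C_eq_intCast,
    Polynomial.coeff_C_of_ne_zero one_ne_zero] at this
  simp at this
  exact hc this

/-- The coefficient of the leading term in the recursion. -/
noncomputable def recCoeff (η : Fin (n + 1) → ℕ) (k : ℕ) : Polynomial ℤ :=
  Polynomial.X * ((η 0 + 1 : ℕ) : Polynomial ℤ) - (rk η 0 : Polynomial ℤ)
    + ((k + 1 : ℕ) : Polynomial ℤ)

lemma recCoeff_ne_zero (η : Fin (n + 1) → ℕ) (k : ℕ) : recCoeff η k ≠ 0 := by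
  have := X_mul_sub_ne_zero (η 0 + 1) (-(rk η 0 : ℤ) + ((k + 1 : ℕ) : ℤ)) (by omega)
  convert this using 1
  rw [recCoeff]
  push_cast; ring

/-- The recursion step, with the factor put at position `k`. -/
noncomputable def recStep (η : Fin (n + 1) → ℕ) (F : MvPolynomial (Fin (n + 1)) (Polynomial ℤ))
    (k : Fin (n + 1)) : MvPolynomial (Fin (n + 1)) (Polynomial ℤ) :=
  C (recCoeff η k) * creation k F
    + ∑ i ∈ Finset.Ioi k, creation i F

/-- Descend from the last position, where the step is a multiple of the creation operator. With c_k
= `recCoeff η k`, the intertwiner from k + 1 to k has factor exactly c_k, because the zero entry at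
k has eigenvalue −(k + 1). Invariance of F makes the swap exchange Φ_k F and Φ_{k+1} F and fix the
Φ_i F with i > k + 1. Since c_{k+1} = c_k + 1, the result is c_{k+1} times the step at k, and the
factor c_{k+1} can be cancelled. -/
lemma isEig_recStep {η : Fin (n + 1) → ℕ} {p : Fin (n + 1)} (hη : ∀ j, p < j → η j = 0)
    {F : MvPolynomial (Fin (n + 1)) (Polynomial ℤ)} (hF : IsIntegralJack η (p + 1) F)
    (k : Fin (n + 1)) (hk : p ≤ k) : IsEig Polynomial.X (shift k η) (recStep η F k) := by
  induction k using Fin.reverseInduction with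
  | last =>
    have : Finset.Ioi (Fin.last n) = ∅ := by
      rw [← Fin.top_eq_last]; exact Finset.Ioi_top
    rw [recStep, this, Finset.sum_empty, add_zero]
    exact hF.eig.creation_last.const_mul _
  | cast k ih =>
    have hlt : p < k.succ := hk.trans_lt Fin.castSucc_lt_succ
    have hne : shift k.succ η k.castSucc ≠ shift k.succ η k.succ := by
      rw [shift_self, shift_succ_castSucc, hη _ hlt]; omega
    have hinv : ∀ τ : Equiv.Perm (Fin (n + 1)), (∀ j ≤ p, τ j = j) → perm τ F = F :=
      fun τ hτ => hF.symm τ fun j hj => hτ j (by rw [Fin.le_def]; omega)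
    have hsw : ∀ j < p, Equiv.swap k.castSucc k.succ j = j := fun j hj =>
      Equiv.swap_apply_of_ne_of_ne (hj.trans_le hk).ne (hj.trans hlt).ne
    have h := (ih hlt.le).intertwine (by simp) hne
    rw [← shift_castSucc_eq, shift_self, shift_succ_castSucc, hη _ hlt,
      rk_shift_self p k.succ hη hlt.le,
      rk_shift_succ_castSucc k (fun j hj => hη j (hk.trans_lt hj))] at h
    refine IsEig.of_const_mul (c := recCoeff η k.succ) (recCoeff_ne_zero _ _) ?_
    · convert h using 1
      have hI : Finset.Ioi k.castSucc = insert k.succ (Finset.Ioi k.succ) := by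
        ext j
        simp only [Finset.mem_Ioi, Finset.mem_insert, Fin.lt_def, Fin.ext_iff, Fin.val_castSucc,
          Fin.val_succ]
        omega
      have h1 : perm (Equiv.swap k.castSucc k.succ) (recStep η F k.succ) =
          C (recCoeff η k.succ) * creation k.castSucc F +
          ∑ i ∈ Finset.Ioi k.succ, creation i F := by
        rw [recStep, map_add, map_mul, rename_C, perm_creation hinv hsw hlt.le,
          Equiv.swap_apply_right, map_sum]
        congr 1
        refine Finset.sum_congr rfl fun i hi => ?_
        have hi' := Finset.mem_Ioi.mp hi
        rw [perm_creation hinv hsw (hlt.trans hi').le, Equiv.swap_apply_of_ne_of_ne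
          (Fin.castSucc_lt_succ.trans hi').ne' hi'.ne']
      rw [h1, recStep, recStep, hI, Finset.sum_insert (by simp)]
      have h2 : (Polynomial.X * ((η 0 + 1 : ℕ) : Polynomial ℤ) - (rk η 0 : Polynomial ℤ)
          - (Polynomial.X * ((0 : ℕ) : Polynomial ℤ) - ((k + 1 : ℕ) : Polynomial ℤ))) =
          recCoeff η k := by
        rw [recCoeff, Nat.cast_zero]; ring
      have h3 : C (recCoeff η k.succ) = C (recCoeff η k) + (1 : MvPolynomial (Fin (n + 1)) _) := by
        rw [← C_1, ← C_add]
        congr 1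
        simp only [recCoeff, Fin.val_succ]
        push_cast; ring
      rw [h2, Fin.val_castSucc, h3]
      ring

/-- At a squarefree monomial avoiding x_0, …, x_p the term Φ_p F contributes nothing, and each of
the |η| + 1 variables present contributes |η|! through its own creation term, giving (|η| + 1)!. -/
lemma isIntegralJack_recStep {η : Fin (n + 1) → ℕ} {p : Fin (n + 1)}
    (hη : ∀ j, p < j → η j = 0) {F : MvPolynomial (Fin (n + 1)) (Polynomial ℤ)}
    (hF : IsIntegralJack η (p + 1) F) : IsIntegralJack (shift p η) (p + 1) (recStep η F p) where
  eig := isEig_recStep hη hF p le_rfl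
  symm σ hσ := by
    have hinv : ∀ τ : Equiv.Perm (Fin (n + 1)), (∀ j ≤ p, τ j = j) → perm τ F = F :=
      fun τ hτ => hF.symm τ fun j hj => hτ j (by rw [Fin.le_def]; omega)
    have hσp : σ p = p := hσ p (by omega)
    have hσ' : ∀ j < p, σ j = j := fun j hj => hσ j (by rw [Fin.lt_def] at hj; omega)
    rw [recStep, map_add, map_mul, rename_C, perm_creation hinv hσ' le_rfl, hσp, map_sum]
    congr 1
    have hfix : ∀ i, p < σ i ↔ p < i := fun i => by
      constructor
      · intro h
        by_contra! h'
        rw [hσ i (by rw [Fin.le_def] at h'; omega)] at h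
        exact absurd h (not_lt.mpr h')
      · intro h
        by_contra! h'
        have := σ.injective (hσ (σ i) (by rw [Fin.le_def] at h'; omega))
        rw [this] at h'
        exact absurd h (not_lt.mpr h')
    refine Finset.sum_equiv σ (fun i => by simp [hfix]) fun i hi => ?_
    exact perm_creation hinv hσ' (Finset.mem_Ioi.mp hi).le
  homog := by
    rw [sum_shift, recStep]
    refine IsHomogeneous.add ?_ (IsHomogeneous.sum _ _ _ fun i _ =>
      creation_isHomogeneous hF.homog i)
    exact (creation_isHomogeneous hF.homog p).C_mul _
  coeff_eq d hd1 hd0 hds := by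
    rw [sum_shift] at hds ⊢
    have hp : d p = 0 := hd0 p (by omega)
    rw [recStep, coeff_add, coeff_C_mul, coeff_creation_of_eq_zero p F hp, mul_zero, zero_add,
      coeff_sum]
    have key : ∀ i ∈ Finset.Ioi p, coeff d (creation i F) =
        (d i : Polynomial ℤ) * ((∑ i, η i).factorial : Polynomial ℤ) := fun i hi => by
      have hpi := Finset.mem_Ioi.mp hi
      by_cases hdi : d i = 0
      · rw [coeff_creation_of_eq_zero i F hdi, hdi]; simp
      · have hdi1 : d i = 1 := by have := hd1 i; omega
        rw [coeff_creation i F hdi, hdi1, Nat.cast_one, one_mul]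
        refine hF.coeff_eq _ (fun j => ?_) (fun j => ?_) ?_
        · rw [Finsupp.equivMapDomain_apply, Finsupp.tsub_apply]
          have := hd1 (i.cycleRange.symm j)
          omega
        · refine Fin.cases (fun _ => ?_) (fun j hj => ?_) j
          · simp [hdi1]
          · rw [Finsupp.equivMapDomain_apply, Finsupp.tsub_apply, Fin.cycleRange_symm_succ]
            have hj' : (j : ℕ) < p := by simpa using hj
            rw [Fin.succAbove_of_castSucc_lt, hd0 j.castSucc (by simp; omega), Nat.zero_sub]
            rw [Fin.lt_def] at *; simp; omega
        · have h1 : ∑ j, (Finsupp.equivMapDomain i.cycleRange (d - Finsupp.single i 1)) j =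
              ∑ j, (d - Finsupp.single i 1 : Fin (n + 1) →₀ ℕ) j := by
            simp only [Finsupp.equivMapDomain_apply]
            exact Equiv.sum_comp i.cycleRange.symm _
          have h2 : ∑ j, (d - Finsupp.single i 1 + Finsupp.single i 1 : Fin (n + 1) →₀ ℕ) j
              = ∑ j, d j := by
            rw [tsub_add_cancel_of_le (by simp [hdi1])]
          simp only [Finsupp.add_apply, Finset.sum_add_distrib] at h2
          have h3 : ∑ j, (Finsupp.single i 1 : Fin (n + 1) →₀ ℕ) j = 1 := by
            simp [Finsupp.single_apply]
          omega
    rw [Finset.sum_congr rfl key, ← Finset.sum_mul, Nat.factorial_succ, ← hds, Nat.cast_mul]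
    congr 1
    rw [Nat.cast_sum]
    refine Finset.sum_subset (Finset.subset_univ _) fun j _ hj => ?_
    rw [Finset.mem_Ioi, not_lt] at hj
    rw [hd0 j (by rw [Fin.le_def] at hj; omega), Nat.cast_zero]

lemma isIntegralJack_zero : IsIntegralJack (fun _ : Fin (n + 1) => 0) 0 1 where
  eig i := by
    have : rk (fun _ : Fin (n + 1) => 0) i = i := by simp [rk, Finset.filter_gt_eq_Iio]
    rw [xi_apply, this]
    have h1 : ∀ j, dd i j (1 : MvPolynomial (Fin (n + 1)) (Polynomial ℤ)) = 0 := fun j =>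
      dd_of_symm i j (by simp)
    simp [h1, theta_apply]
  symm σ _ := by simp
  homog := by simpa using isHomogeneous_one _ _
  coeff_eq d _ _ hd := by
    have : d = 0 := by
      ext i
      simp only [Finset.sum_const_zero, Finset.sum_eq_zero_iff, Finset.mem_univ, true_imp_iff] at hd
      exact hd i
    simp [this]

/-- Outer induction on the degree, inner induction on the vanishing bound. If the last admissible
entry is nonzero, the composition is a shift of one of smaller degree; otherwise, or if there is no
such position, the bound is lowered. -/
theorem exists_isIntegralJack (N : ℕ) : ∀ (m : ℕ) (η : Fin (n + 1) → ℕ),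
    (∀ j : Fin (n + 1), m ≤ j → η j = 0) → ∑ i, η i = N → ∃ F, IsIntegralJack η m F := by
  induction N with
  | zero =>
    intro m η _ hN
    have h0 : η = fun _ => 0 := by
      ext i
      simp only [Finset.sum_eq_zero_iff, Finset.mem_univ, true_imp_iff] at hN
      exact hN i
    subst h0
    have h := isIntegralJack_zero (n := n)
    exact ⟨1, h.eig, fun σ _ => h.symm σ (by simp), h.homog,
      fun d h1 _ => h.coeff_eq d h1 (by simp)⟩
  | succ N ihN =>
    intro m
    induction m with
    | zero =>
      intro η hη hN
      rw [Finset.sum_eq_zero fun i _ => hη i (Nat.zero_le _)] at hN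
      omega
    | succ m ihm =>
      intro η hη hN
      by_cases hm : ∃ p : Fin (n + 1), (p : ℕ) = m ∧ η p ≠ 0
      · obtain ⟨p, rfl, hp⟩ := hm
        set η' : Fin (n + 1) → ℕ := fun i => η (p.cycleRange.symm i) - if i = 0 then 1 else 0
          with hη'
        have hs : shift p η' = η := shift_pred p hp
        have hz : ∀ j, p < j → η' j = 0 := fun j hj => by
          have h1 := shift_of_lt hj η'
          rw [hs] at h1
          rw [← h1]
          exact hη j (by rw [Fin.lt_def] at hj; omega)
        have hN' : ∑ i, η' i = N := by
          have := sum_shift p η'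
          rw [hs, hN] at this
          omega
        obtain ⟨F, hF⟩ := ihN (p + 1) η'
          (fun j hj => hz j (by rw [Fin.lt_def]; omega)) hN'
        have := isIntegralJack_recStep hz hF
        rw [hs] at this
        exact ⟨_, this⟩
      · push Not at hm
        obtain ⟨F, hF⟩ := ihm η (fun j hj => by
          rcases hj.eq_or_lt with h | h
          · exact hm j h.symm
          · exact hη j h) hN
        exact ⟨F, hF.eig, fun σ h => hF.symm σ fun j hj => h j (by omega), hF.homog,
          fun d h1 h2 => hF.coeff_eq d h1 fun i hi => h2 i (by omega)⟩

end Recursion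

/-! ### Triangularity of joint eigenfunctions with respect to dominance. -/

section Triangularity

variable {n : ℕ}

/-- The sum of the truncated differences `κ_i - t`; the partitions of `N` are compared in
dominance order by these numbers. -/
def excess (t : ℕ) (κ : Fin n → ℕ) : ℕ := ∑ i, (κ i - t)

lemma excess_comp_equiv (t : ℕ) (κ : Fin n → ℕ) (σ : Equiv.Perm (Fin n)) :
    excess t (κ ∘ σ) = excess t κ :=
  Equiv.sum_comp σ fun i => κ i - t

/-- Convexity of y ↦ max(y − t, 0): from two equal entries, adding r to one of them gives the
largest sum among all ways of distributing r. -/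
lemma excess_single_add_single {i j : Fin n} (hij : i ≠ j) (t : ℕ) {ρ : Fin n →₀ ℕ}
    (hρ : ρ i = ρ j) {u v r : ℕ} (h : u + v = r) :
    excess t (ρ + Finsupp.single i u + Finsupp.single j v) ≤
      excess t (ρ + Finsupp.single i r) := by
  have split : ∀ G : Fin n → ℕ,
      ∑ k, G k = (G i + G j) + ∑ k ∈ ({i, j} : Finset (Fin n))ᶜ, G k := fun G => by
    rw [← Finset.sum_pair hij, Finset.sum_add_sum_compl]
  unfold excess
  rw [split, split]
  have hrest : ∑ k ∈ ({i, j} : Finset (Fin n))ᶜ,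
      ((ρ + Finsupp.single i u + Finsupp.single j v) k - t) =
      ∑ k ∈ ({i, j} : Finset (Fin n))ᶜ, ((ρ + Finsupp.single i r) k - t) := by
    refine Finset.sum_congr rfl fun k hk => ?_
    simp only [Finset.mem_compl, Finset.mem_insert, Finset.mem_singleton, not_or] at hk
    simp [Ne.symm hk.1, Ne.symm hk.2]
  rw [hrest]
  simp [hij, hij.symm, hρ]
  omega

variable {R : Type*} [CommRing R]

/-- The polynomials all of whose coefficients at monomials of excess larger than `M` lie
in `A`. -/
def excessFilt (n t M : ℕ) (A : AddSubgroup R) : AddSubgroup (MvPolynomial (Fin n) R) where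
  carrier := {f | ∀ κ : Fin n →₀ ℕ, M < excess t κ → coeff κ f ∈ A}
  add_mem' hf hg κ h := by rw [coeff_add]; exact A.add_mem (hf κ h) (hg κ h)
  zero_mem' κ _ := by rw [coeff_zero]; exact A.zero_mem
  neg_mem' hf κ h := by rw [coeff_neg]; exact A.neg_mem (hf κ h)

lemma mem_excessFilt {t M : ℕ} {A : AddSubgroup R} {f : MvPolynomial (Fin n) R} :
    f ∈ excessFilt n t M A ↔ ∀ κ : Fin n →₀ ℕ, M < excess t κ → coeff κ f ∈ A := Iff.rfl

lemma monomial_mem_excessFilt {t M : ℕ} {A : AddSubgroup R} {κ : Fin n →₀ ℕ} {c : R} :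
    monomial κ c ∈ excessFilt n t M A ↔ (M < excess t κ → c ∈ A) := by
  rw [mem_excessFilt]
  constructor
  · intro h hκ; simpa using h κ hκ
  · intro h κ' hκ'
    rw [coeff_monomial]
    split_ifs with he
    · subst he; exact h hκ'
    · exact A.zero_mem

variable [IsDomain R]

lemma dd_X_pow_mul {i j : Fin n} (hij : i ≠ j) (r : ℕ) {g : MvPolynomial (Fin n) R}
    (hg : perm (Equiv.swap i j) g = g) :
    dd i j (X i ^ r * g) = ∑ u ∈ Finset.range r, X i ^ u * X j ^ (r - 1 - u) * g := by
  refine (eq_dd hij ?_).symm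
  rw [map_mul, map_pow, rename_X, Equiv.swap_apply_left, hg, ← Finset.sum_mul, ← sub_mul,
    ← mul_assoc]
  congr 1
  rw [mul_comm]
  exact geom_sum₂_mul _ _ _

/-- Write the monomial as x_i^r times a monomial invariant under the swap. The divided difference is
then a geometric sum, and the extra factor x_i or x_j brings every term to x_i^u x_j^v with u + v =
r. -/
lemma X_mul_dd_monomial_mem {t M : ℕ} {A : AddSubgroup R} {i j : Fin n} (hij : i ≠ j)
    {κ : Fin n →₀ ℕ} {c : R} (h : monomial κ c ∈ excessFilt n t M A) (hκ : κ j ≤ κ i)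
    {l : Fin n} (hl : l = i ∨ l = j) : X l * dd i j (monomial κ c) ∈ excessFilt n t M A := by
  set r := κ i - κ j with hr
  set ρ : Fin n →₀ ℕ := κ - Finsupp.single i r with hρ
  have hρκ : κ = ρ + Finsupp.single i r := by
    rw [hρ, tsub_add_cancel_of_le]
    rw [Finsupp.single_le_iff]; omega
  have hρij : ρ i = ρ j := by simp [hρ, hij]; omega
  have hmon : (monomial κ c : MvPolynomial (Fin n) R) = X i ^ r * monomial ρ c := by
    rw [X_pow_eq_monomial, monomial_mul, one_mul, add_comm, ← hρκ]
  have hinv : perm (Equiv.swap i j) (monomial ρ c) = monomial ρ c := by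
    rw [rename_monomial]
    congr 2
    ext k
    obtain ⟨k, rfl⟩ := (Equiv.swap i j).surjective k
    rw [Finsupp.mapDomain_apply (Equiv.swap i j).injective]
    rcases eq_or_ne k i with rfl | hki
    · rw [Equiv.swap_apply_left, hρij]
    · rcases eq_or_ne k j with rfl | hkj
      · rw [Equiv.swap_apply_right, hρij]
      · rw [Equiv.swap_apply_of_ne_of_ne hki hkj]
  have key : ∀ u v : ℕ, u + v = r →
      X i ^ u * X j ^ v * monomial ρ c ∈ excessFilt n t M A := fun u v huv => by
    have : (X i ^ u * X j ^ v * monomial ρ c : MvPolynomial (Fin n) R) =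
        monomial (ρ + Finsupp.single i u + Finsupp.single j v) c := by
      rw [X_pow_eq_monomial, X_pow_eq_monomial, monomial_mul, monomial_mul, one_mul, one_mul]
      congr 2
      abel
    rw [this, monomial_mem_excessFilt]
    intro hlt
    rw [hρκ, monomial_mem_excessFilt] at h
    exact h (hlt.trans_le (excess_single_add_single hij t hρij huv))
  rw [hmon, dd_X_pow_mul hij r hinv, Finset.mul_sum]
  refine AddSubgroup.sum_mem _ fun u hu => ?_
  have hu' := Finset.mem_range.mp hu
  rcases hl with rfl | rfl
  · have := key (u + 1) (r - 1 - u) (by omega)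
    rwa [pow_succ', mul_assoc, mul_assoc, ← mul_assoc (X l ^ u)] at this
  · have := key u (r - 1 - u + 1) (by omega)
    rwa [pow_succ', mul_left_comm (X i ^ u), mul_assoc] at this

lemma X_mul_dd_mem {t M : ℕ} {A : AddSubgroup R} (i j : Fin n) {f : MvPolynomial (Fin n) R}
    (h : f ∈ excessFilt n t M A) {l : Fin n} (hl : l = i ∨ l = j) :
    X l * dd i j f ∈ excessFilt n t M A := by
  rcases eq_or_ne i j with rfl | hij
  · simp
  rw [f.as_sum, map_sum, Finset.mul_sum]
  refine AddSubgroup.sum_mem _ fun κ _ => ?_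
  have hmem : monomial κ (coeff κ f) ∈ excessFilt n t M A :=
    monomial_mem_excessFilt.mpr (h κ)
  rcases le_total (κ j) (κ i) with hκ | hκ
  · exact X_mul_dd_monomial_mem hij hmem hκ hl
  · have := X_mul_dd_monomial_mem hij.symm hmem hκ hl.symm
    rw [dd_comm, mul_neg] at this
    exact (AddSubgroup.neg_mem_iff _).mp this

/-- The monomials of a joint eigenfunction are dominated by its index: compare coefficients of
the leading power of the parameter, on which the Cherednik operators act diagonally. -/
theorem IsEig.excess_le {η : Fin n → ℕ} {F : MvPolynomial (Fin n) (Polynomial ℤ)}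
    (hF : IsEig Polynomial.X η F) (t : ℕ) {κ : Fin n →₀ ℕ} (hκ : coeff κ F ≠ 0) :
    excess t κ ≤ excess t η := by
  set A : ℕ → AddSubgroup (Polynomial ℤ) := fun k => (Polynomial.degreeLT ℤ k).toAddSubgroup
    with hA
  have hmA : ∀ k (c : Polynomial ℤ), c ∈ A k ↔ c.degree < k := fun k c => by
    simp [hA, Polynomial.mem_degreeLT]
  -- The coefficients at undominated monomials lose one degree in the parameter at each step, hence
  -- vanish.
  have step : ∀ k, F ∈ excessFilt n t (excess t η) (A (k + 1)) →
      F ∈ excessFilt n t (excess t η) (A k) := fun k hk κ hκ => by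
    obtain ⟨i, hi⟩ : ∃ i, κ i ≠ η i := by
      by_contra! h
      rw [funext h] at hκ
      exact lt_irrefl _ hκ
    have h1 := congrArg (coeff κ) (hF i)
    rw [xi_apply, coeff_sub, coeff_add, coeff_C_mul, coeff_C_mul, coeff_theta,
      ← C_eq_coe_nat, coeff_C_mul] at h1
    have hc := hk κ hκ
    have hS : coeff κ (∑ j, X (max i j) * dd i j F) ∈ A (k + 1) :=
      AddSubgroup.sum_mem _ (fun j _ => X_mul_dd_mem i j hk (max_choice i j)) κ hκ
    -- The parameter occurs only in the Euler term. Isolating it bounds the degree of X·(κ_i −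
    -- η_i)·coeff by the same bound as the other terms, so the coefficient itself has smaller
    -- degree.
    have h2 : Polynomial.X * ((((κ i : ℤ) - η i : ℤ) : Polynomial ℤ) * coeff κ F) =
        ((i : ℕ) : ℤ) • coeff κ F - (rk η i : ℤ) • coeff κ F
          - coeff κ (∑ j, X (max i j) * dd i j F) := by
      simp only [zsmul_eq_mul]
      push_cast
      linear_combination h1
    have h3 : Polynomial.X * ((((κ i : ℤ) - η i : ℤ) : Polynomial ℤ) * coeff κ F) ∈ A (k + 1) := by
      rw [h2]
      exact AddSubgroup.sub_mem _ (AddSubgroup.sub_mem _ (AddSubgroup.zsmul_mem _ hc _)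
        (AddSubgroup.zsmul_mem _ hc _)) hS
    rw [hmA, Polynomial.degree_mul, Polynomial.degree_mul, Polynomial.degree_X,
      ← Polynomial.C_eq_intCast, Polynomial.degree_C (by
        rw [Int.cast_ne_zero, sub_ne_zero]; exact_mod_cast hi), zero_add] at h3
    rw [hmA]
    by_cases h0 : coeff κ F = 0
    · rw [h0, Polynomial.degree_zero]; exact WithBot.bot_lt_coe k
    · rw [Polynomial.degree_eq_natDegree h0] at h3 ⊢
      have : 1 + (coeff κ F).natDegree < k + 1 := by exact_mod_cast h3
      exact_mod_cast (by omega : (coeff κ F).natDegree < k)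
  have down : ∀ k, F ∈ excessFilt n t (excess t η) (A k) →
      F ∈ excessFilt n t (excess t η) (A 0) := fun k => by
    induction k with
    | zero => exact id
    | succ k ih => exact fun h => ih (step k h)
  have top : F ∈ excessFilt n t (excess t η)
      (A (F.support.sup (fun κ => (coeff κ F).natDegree) + 1)) := fun κ _ => by
    rw [hmA]
    by_cases h0 : coeff κ F = 0
    · rw [h0, Polynomial.degree_zero]; exact WithBot.bot_lt_coe _
    · have := Finset.le_sup (f := fun κ => (coeff κ F).natDegree) (mem_support_iff.mpr h0)
      rw [Polynomial.degree_eq_natDegree h0]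
      exact_mod_cast Nat.lt_succ_of_le this
  by_contra! hlt
  have := down _ top κ hlt
  rw [hmA, Nat.cast_zero, Nat.WithBot.lt_zero_iff, Polynomial.degree_eq_bot] at this
  exact hκ this

end Triangularity

/-! ### Partitions, partial sums and dominance. -/

section Parts

variable {N : ℕ}

/-- The `i`-th largest part of `lam`, or `0`. -/
def part (lam : N.Partition) (i : ℕ) : ℕ := (lam.parts.sort (· ≥ ·)).getD i 0

lemma sum_range_getD (g : ℕ → ℕ) (hg : g 0 = 0) (l : List ℕ) : ∀ K, l.length ≤ K →
    ∑ i ∈ Finset.range K, g (l.getD i 0) = (l.map g).sum := by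
  induction l with
  | nil => intro K _; simp [hg]
  | cons x l ih =>
    intro K hK
    obtain ⟨K, rfl⟩ : ∃ K', K = K' + 1 := ⟨K - 1, by simp at hK; omega⟩
    rw [Finset.sum_range_succ']
    simp only [List.getD_cons_succ, List.getD_cons_zero, List.map_cons, List.sum_cons]
    rw [ih K (by simpa using hK), add_comm]

lemma sum_range_part (lam : N.Partition) (g : ℕ → ℕ) (hg : g 0 = 0) {K : ℕ}
    (hK : len lam ≤ K) : ∑ i ∈ Finset.range K, g (part lam i) = (lam.parts.map g).sum := by
  unfold part
  rw [sum_range_getD g hg _ K (by simpa [len] using hK), ← Multiset.sum_coe, ← Multiset.map_coe,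
    Multiset.sort_eq]

lemma part_pos_iff (lam : N.Partition) (i : ℕ) : 0 < part lam i ↔ i < len lam := by
  have hlen : (lam.parts.sort (· ≥ ·)).length = len lam := by simp [len]
  unfold part
  constructor
  · intro h
    by_contra! h'
    rw [List.getD_eq_default _ _ (by omega)] at h
    exact lt_irrefl _ h
  · intro h
    rw [List.getD_eq_getElem _ _ (by omega)]
    refine lam.parts_pos ?_
    rw [← Multiset.mem_sort (r := (· ≥ ·))]
    exact List.getElem_mem _

lemma part_antitone (lam : N.Partition) : Antitone (part lam) := by
  intro i j hij
  rcases hij.eq_or_lt with rfl | hij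
  · rfl
  have hlen : (lam.parts.sort (· ≥ ·)).length = len lam := by simp [len]
  rcases lt_or_ge j (len lam) with hj | hj
  · unfold part
    rw [List.getD_eq_getElem _ _ (by omega), List.getD_eq_getElem _ _ (by omega)]
    have := List.pairwise_iff_getElem.mp (Multiset.pairwise_sort lam.parts (· ≥ ·)) i j
      (by omega) (by omega) hij
    exact this
  · have : part lam j = 0 := by
      by_contra h
      have := (part_pos_iff lam j).mp (Nat.pos_of_ne_zero h)
      omega
    rw [this]; exact Nat.zero_le _

lemma partialSum_eq (lam : N.Partition) (k : ℕ) :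
    partialSum lam k = ∑ i ∈ Finset.range k, part lam i := by
  induction k with
  | zero => simp [partialSum]
  | succ k ih =>
    rw [Finset.sum_range_succ, ← ih, partialSum, partialSum, List.take_add_one, List.sum_append,
      part]
    congr 1
    rw [List.getD_eq_getElem?_getD]
    cases (lam.parts.sort (· ≥ ·))[k]? <;> simp

lemma sum_part (lam : N.Partition) {K : ℕ} (hK : len lam ≤ K) :
    ∑ i ∈ Finset.range K, part lam i = N := by
  have := sum_range_part lam id rfl hK
  simpa [lam.parts_sum] using this

/-- Take t to be the part of λ following the first k. Truncation at t then loses nothing for λ: all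
parts up to there are at least t and the later ones contribute 0. For μ, adding k·t to the truncated
sum bounds the partial sum from above. -/
lemma domLE_of_excess {lam mu : N.Partition}
    (h : ∀ t, (mu.parts.map (· - t)).sum ≤ (lam.parts.map (· - t)).sum) : DomLE mu lam := by
  intro k
  set t := part lam k with ht
  set K := max k (max (len lam) (len mu)) with hK
  have hk : Finset.range k ⊆ Finset.range K := Finset.range_mono (le_max_left _ _)
  have h1 := sum_range_part mu (· - t) (Nat.zero_sub t) (K := K) (by omega)
  have h2 := sum_range_part lam (· - t) (Nat.zero_sub t) (K := K) (by omega)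
  have h3 : ∑ i ∈ Finset.range k, (part mu i - t) ≤ ∑ i ∈ Finset.range K, (part mu i - t) :=
    Finset.sum_le_sum_of_subset hk
  have h4 : ∑ i ∈ Finset.range k, (part lam i - t) = ∑ i ∈ Finset.range K, (part lam i - t) := by
    refine Finset.sum_subset hk fun i _ hi => ?_
    rw [Finset.mem_range, not_lt] at hi
    exact Nat.sub_eq_zero_of_le (part_antitone lam hi)
  have h5 : ∑ i ∈ Finset.range k, part mu i ≤ ∑ i ∈ Finset.range k, ((part mu i - t) + t) :=
    Finset.sum_le_sum fun i _ => by omega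
  have h6 : ∑ i ∈ Finset.range k, ((part lam i - t) + t) = ∑ i ∈ Finset.range k, part lam i := by
    refine Finset.sum_congr rfl fun i hi => ?_
    have := part_antitone lam (Finset.mem_range.mp hi).le
    omega
  rw [Finset.sum_add_distrib] at h5 h6
  rw [partialSum_eq, partialSum_eq]
  have := h t
  omega

lemma excess_eq_of_vals {n : ℕ} {κ : Fin n →₀ ℕ} {mu : N.Partition} (h : vals κ = mu.parts)
    (t : ℕ) : excess t κ = (mu.parts.map (· - t)).sum := by
  rw [← h, vals, Multiset.map_map, excess]
  change _ = ∑ i ∈ κ.support, (κ i - t)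
  symm
  refine Finset.sum_subset (Finset.subset_univ _) fun i _ hi => ?_
  rw [Finsupp.notMem_support_iff.mp hi, Nat.zero_sub]

lemma excess_part {n : ℕ} (lam : N.Partition) (hn : len lam ≤ n) (t : ℕ) :
    excess t (fun i : Fin n => part lam i) = (lam.parts.map (· - t)).sum := by
  rw [← sum_range_part lam (· - t) (Nat.zero_sub t) hn, excess,
    Finset.sum_range (fun i => part lam i - t)]

/-- `n(λ) = ∑ (i - 1) λ_i` separates comparable partitions. -/
lemma eq_of_domLE_of_sum_eq {K : ℕ} {lam mu : N.Partition} (hle : DomLE mu lam)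
    (hl : len lam ≤ K) (hm : len mu ≤ K)
    (h : ∑ i ∈ Finset.range K, i * part lam i = ∑ i ∈ Finset.range K, i * part mu i) :
    mu = lam := by
  -- Summation by parts: with equal totals, equal weighted sums force equality in every inequality
  -- between partial sums.
  have abel : ∀ nu : N.Partition, ∀ k, ∑ j ∈ Finset.range k, partialSum nu (j + 1)
      + ∑ i ∈ Finset.range k, i * part nu i = k * partialSum nu k := fun nu k => by
    induction k with
    | zero => simp
    | succ k ih =>
      rw [Finset.sum_range_succ, Finset.sum_range_succ]
      have : partialSum nu (k + 1) = partialSum nu k + part nu k := by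
        rw [partialSum_eq, partialSum_eq, Finset.sum_range_succ]
      rw [this]
      linarith
  have htot : partialSum mu K = partialSum lam K := by
    rw [partialSum_eq, partialSum_eq, sum_part mu hm, sum_part lam hl]
  have hsum : ∑ j ∈ Finset.range K, partialSum mu (j + 1)
      = ∑ j ∈ Finset.range K, partialSum lam (j + 1) := by
    have h1 := abel mu K
    have h2 := abel lam K
    rw [htot] at h1
    omega
  have heq := (Finset.sum_eq_sum_iff_of_le fun j _ => hle (j + 1)).mp hsum
  have hps : ∀ j, j ≤ K → partialSum mu j = partialSum lam j := fun j hj => by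
    cases j with
    | zero => simp [partialSum]
    | succ j => exact heq j (Finset.mem_range.mpr (by omega))
  have hpart : ∀ j, j < K → part mu j = part lam j := fun j hj => by
    have h1 := hps (j + 1) (by omega)
    have h2 := hps j hj.le
    rw [partialSum_eq, partialSum_eq] at h1 h2
    rw [Finset.sum_range_succ, Finset.sum_range_succ] at h1
    omega
  have hcount : ∀ nu : N.Partition, len nu ≤ K → ∀ c, c ≠ 0 → nu.parts.count c =
      ∑ i ∈ Finset.range K, if part nu i = c then 1 else 0 := fun nu hnu c hc => by
    rw [sum_range_part nu (fun x => if x = c then 1 else 0) (by simp [hc.symm]) hnu]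
    generalize nu.parts = s
    induction s using Multiset.induction with
    | empty => simp
    | cons x s ih => rw [Multiset.count_cons, Multiset.map_cons, Multiset.sum_cons, ih, add_comm]; simp [eq_comm]
  refine Nat.Partition.ext (Multiset.ext.mpr fun c => ?_)
  rcases eq_or_ne c 0 with rfl | hc
  · rw [Multiset.count_eq_zero_of_notMem fun h => (mu.parts_pos h).false,
      Multiset.count_eq_zero_of_notMem fun h => (lam.parts_pos h).false]
  · rw [hcount mu hm c hc, hcount lam hl c hc]
    refine Finset.sum_congr rfl fun i hi => ?_
    rw [hpart i (Finset.mem_range.mp hi)]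

end Parts

/-! ### Iterated creation as rotation of a product with x_1⋯x_j. -/

section Rotation

variable {n : ℕ}

/-- The rotation `i ↦ i - 1` of the variables. -/
abbrev rot (n : ℕ) : Equiv.Perm (Fin (n + 1)) := (Fin.last n).cycleRange.symm

lemma rot_val (i : Fin (n + 1)) : (rot n i : ℕ) = if (i : ℕ) = 0 then n else i - 1 := by
  refine Fin.cases ?_ (fun i => ?_) i
  · simp [rot]
  · rw [rot, cycleRange_last_symm_succ]; simp

lemma rot_pow_val (j : ℕ) (hj : j ≤ n + 1) (i : Fin (n + 1)) :
    ((rot n ^ j) i : ℕ) = if (i : ℕ) < j then i + (n + 1) - j else i - j := by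
  induction j with
  | zero => simp
  | succ j ih =>
    rw [pow_succ', Equiv.Perm.mul_apply, rot_val, ih (by omega)]
    have := i.isLt
    split_ifs <;> omega

variable {R : Type*} [CommRing R]

/-- The product of the first `j` variables. -/
noncomputable def leadProd (n : ℕ) (R : Type*) [CommRing R] (j : ℕ) :
    MvPolynomial (Fin (n + 1)) R :=
  ∏ i ∈ Finset.univ.filter (fun i : Fin (n + 1) => (i : ℕ) < j), X i

lemma leadProd_succ (j : Fin (n + 1)) : leadProd n R (j + 1) = X j * leadProd n R j := by
  unfold leadProd
  rw [← Finset.prod_insert (by simp)]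
  congr 1
  ext i
  simp only [Finset.mem_filter, Finset.mem_univ, true_and, Finset.mem_insert, Fin.ext_iff]
  omega

/-- The exponent vector of `leadProd`. -/
noncomputable def leadExp (n j : ℕ) : Fin (n + 1) →₀ ℕ :=
  Finsupp.equivFunOnFinite.symm fun i => if (i : ℕ) < j then 1 else 0

lemma leadExp_apply (j : ℕ) (i : Fin (n + 1)) :
    leadExp n j i = if (i : ℕ) < j then 1 else 0 := rfl

lemma leadProd_eq (j : ℕ) : leadProd n R j = monomial (leadExp n j) 1 := by
  have : leadExp n j = ∑ i ∈ Finset.univ.filter (fun i : Fin (n + 1) => (i : ℕ) < j),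
      Finsupp.single i 1 := by
    ext k
    simp [leadExp_apply, Finsupp.finsetSum_apply, Finsupp.single_apply, Finset.sum_ite_eq']
  rw [leadProd, this, monomial_sum_one]
  rfl

lemma perm_leadProd {j : ℕ} {σ : Equiv.Perm (Fin (n + 1))}
    (hσ : ∀ i : Fin (n + 1), (i : ℕ) < j → σ i = i) :
    perm σ (leadProd n R j) = leadProd n R j := by
  unfold leadProd
  rw [map_prod]
  refine Finset.prod_congr rfl fun i hi => ?_
  rw [rename_X, hσ i (by simpa using hi)]

lemma sum_leadExp {j : ℕ} (hj : j ≤ n + 1) : ∑ i, leadExp n j i = j := by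
  simp only [leadExp_apply, Finset.sum_boole, Nat.cast_id]
  rw [Fin.card_filter_val_lt, min_eq_right hj]

variable [IsDomain R] {a : R}

/-- The displayed polynomial is the j-fold creation operator applied to F: each application
multiplies by the last variable, which the accumulated rotation identifies with the next of the
leading variables. -/
lemma IsEig.rotate {ν : Fin (n + 1) → ℕ} {F : MvPolynomial (Fin (n + 1)) R} (hF : IsEig a ν F)
    (j : ℕ) (hj : j ≤ n + 1) :
    IsEig a ((fun i => ν i + leadExp n j i) ∘ ((rot n ^ j)⁻¹ : Equiv.Perm _))
      (perm (rot n ^ j) (leadProd n R j * F)) := by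
  induction j with
  | zero => simpa [leadProd, leadExp_apply, perm_one] using hF
  | succ j ih =>
    have h := (ih (by omega)).creation_last
    have hlast : (rot n ^ (j + 1)) ⟨j, by omega⟩ = Fin.last n := by
      apply Fin.ext
      rw [rot_pow_val _ hj]
      simp; omega
    convert h using 1
    · ext i
      obtain ⟨i, rfl⟩ := (rot n ^ (j + 1)).surjective i
      have hi : (Fin.last n).cycleRange ((rot n ^ (j + 1)) i) = (rot n ^ j) i := by
        rw [pow_succ', Equiv.Perm.mul_apply, Equiv.apply_symm_apply]
      have hiff : (rot n ^ (j + 1)) i = Fin.last n ↔ (i : ℕ) = j := by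
        rw [← hlast, (rot n ^ (j + 1)).apply_eq_iff_eq, Fin.ext_iff]
      have hinv : ∀ (σ : Equiv.Perm (Fin (n + 1))) (x : Fin (n + 1)), σ⁻¹ (σ x) = x :=
        fun σ x => σ.symm_apply_apply x
      simp only [shift, Function.comp_apply, leadExp_apply, hi, hiff, hinv]
      split_ifs <;> omega
    · have hj' := leadProd_succ (R := R) (⟨j, by omega⟩ : Fin (n + 1))
      simp only at hj'
      rw [creation_apply, hj', mul_assoc, map_mul, rename_X, hlast, pow_succ', perm_mul]

end Rotation

/-! ### The linear coefficient of the eigenvalue. -/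

section SquareSum

lemma coeff_one_eigenvalue {ι : Type*} (s : Finset ι) (b c : ι → ℕ) :
    (∑ i ∈ s, ((Polynomial.X : Polynomial ℤ) * (b i : Polynomial ℤ) - (c i : Polynomial ℤ)) ^ 2).coeff 1
      = -2 * ((∑ i ∈ s, c i * b i : ℕ) : ℤ) := by
  rw [Polynomial.finsetSum_coeff, Nat.cast_sum, Finset.mul_sum]
  refine Finset.sum_congr rfl fun i _ => ?_
  have : ((Polynomial.X : Polynomial ℤ) * (b i : Polynomial ℤ) - (c i : Polynomial ℤ)) ^ 2 =
      Polynomial.C ((b i : ℤ) ^ 2) * Polynomial.X ^ 2 +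
      Polynomial.C (-2 * (c i * b i : ℤ)) * Polynomial.X + Polynomial.C ((c i : ℤ) ^ 2) := by
    simp only [Polynomial.C_mul, Polynomial.C_pow, Polynomial.C_neg, map_natCast, map_ofNat]
    ring
  rw [this, Polynomial.coeff_add, Polynomial.coeff_add, Polynomial.coeff_C_mul,
    Polynomial.coeff_C_mul, Polynomial.coeff_X_pow, Polynomial.coeff_X_one,
    Polynomial.coeff_C_of_ne_zero one_ne_zero]
  simp

end SquareSum

/-! ### Symmetrization over injections. -/

section Symmetrization

variable {n : ℕ} {R : Type*} [CommRing R]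

/-- A permutation extending an injection of the first `m` indices. -/
noncomputable def extendPerm {m : ℕ} (ι : {i : Fin n // (i : ℕ) < m} ↪ Fin n) :
    Equiv.Perm (Fin n) := by
  classical
  exact (Equiv.ofInjective ι ι.injective).extendSubtype

lemma extendPerm_apply {m : ℕ} (ι : {i : Fin n // (i : ℕ) < m} ↪ Fin n) (i : Fin n)
    (hi : (i : ℕ) < m) : extendPerm ι i = ι ⟨i, hi⟩ := by
  classical
  unfold extendPerm
  rw [Equiv.extendSubtype_apply_of_mem _ i hi]
  rfl

open Classical in
/-- Symmetrization of a polynomial invariant under the permutations of the variables of index at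
least `m`. -/
noncomputable def symmetrize (m : ℕ) (G : MvPolynomial (Fin n) R) : MvPolynomial (Fin n) R :=
  ∑ ι : {i : Fin n // (i : ℕ) < m} ↪ Fin n, perm (extendPerm ι) G

/-- Composition with π permutes the injections, and two extensions of one injection differ by a
permutation that fixes the first m indices, which G does not see. Thus the choice of extensions is
harmless. -/
lemma perm_symmetrize {m : ℕ} {G : MvPolynomial (Fin n) R}
    (hG : ∀ σ : Equiv.Perm (Fin n), (∀ i : Fin n, (i : ℕ) < m → σ i = i) → perm σ G = G)
    (π : Equiv.Perm (Fin n)) : perm π (symmetrize m G) = symmetrize m G := by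
  classical
  unfold symmetrize
  rw [map_sum]
  refine Fintype.sum_equiv (Equiv.embeddingCongr (Equiv.refl _) π) _ _ fun ι => ?_
  set ι' := Equiv.embeddingCongr (Equiv.refl _) π ι with hι'
  have h := hG ((extendPerm ι')⁻¹ * (π * extendPerm ι)) fun i hi => by
    rw [Equiv.Perm.mul_apply, Equiv.Perm.inv_eq_iff_eq, Equiv.Perm.mul_apply,
      extendPerm_apply _ i hi, extendPerm_apply _ i hi, hι']
    simp [Equiv.embeddingCongr]
  conv_rhs => rw [← h]
  rw [← perm_mul, ← perm_mul, mul_inv_cancel_left]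

lemma card_embedding_filter {K V : Type*} [Fintype K] [Fintype V] [DecidableEq K] [DecidableEq V]
    (T : Finset V) :
    (Finset.univ.filter fun ι : K ↪ V => ∀ k, ι k ∈ T).card =
      T.card.descFactorial (Fintype.card K) := by
  rw [← Fintype.card_coe T, ← Fintype.card_embedding_eq, ← Fintype.card_subtype]
  refine Fintype.card_congr
    { toFun := fun ι => ⟨fun k => ⟨ι.1 k, ι.2 k⟩, fun k l h => ι.1.injective (by simpa using h)⟩
      invFun := fun f => ⟨f.trans (Function.Embedding.subtype _), fun k => (f k).2⟩
      left_inv := fun ι => rfl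
      right_inv := fun f => rfl }

end Symmetrization

/-- The integral form of the symmetric Jack polynomial. -/
theorem exists_symmetric_eigenfunction {n N : ℕ} (hN : N ≤ n + 1) (lam : N.Partition) :
    ∃ (S : MvPolynomial (Fin (n + 1)) (Polynomial ℤ)) (e : Polynomial ℤ),
      S.IsSymmetric ∧ S.IsHomogeneous N ∧
      (∀ d : Fin (n + 1) →₀ ℕ, (∀ i, d i ≤ 1) → ∑ i, d i = N →
        coeff d S = (N.factorial : Polynomial ℤ)) ∧
      (∀ (κ : Fin (n + 1) →₀ ℕ) (mu : N.Partition), vals κ = mu.parts → coeff κ S ≠ 0 →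
        DomLE mu lam) ∧
      xiSq Polynomial.X S = C e * S ∧
      e.coeff 1 = -2 * ((∑ i ∈ Finset.range (n + 1), i * part lam i : ℕ) : ℤ) := by
  classical
  set m := len lam with hm
  have hmN : m ≤ N := card_parts_le lam
  have hmn : m ≤ n + 1 := hmN.trans hN
  -- One is removed from each of the m positive parts and restored below by the factor x_1⋯x_m; the
  -- parts beyond m are zero, so the truncated subtraction leaves them.
  set ν : Fin (n + 1) → ℕ := fun i => part lam i - 1 with hν
  have hνl : ∀ i : Fin (n + 1), ν i + leadExp n m i = part lam i := fun i => by
    rw [leadExp_apply]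
    have := part_pos_iff lam i
    simp only [hν]
    split_ifs <;> omega
  have hsum : ∑ i : Fin (n + 1), part lam i = N := by
    rw [← Finset.sum_range (fun i => part lam i), sum_part lam hmn]
  have hνsum : ∑ i, ν i = N - m := by
    have := sum_leadExp hmn
    rw [← hsum, ← Finset.sum_congr rfl fun i _ => hνl i, Finset.sum_add_distrib]
    omega
  obtain ⟨F, hF⟩ := exists_isIntegralJack (n := n) (N - m) m ν (fun j hj => by
    have := part_pos_iff lam j
    simp only [hν]; omega) hνsum
  set G := leadProd n (Polynomial ℤ) m * F with hG
  set τ := rot n ^ m with hτ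
  set η : Fin (n + 1) → ℕ := (fun i => part lam (i : Fin (n + 1))) ∘ (τ⁻¹ : Equiv.Perm _) with hη
  -- The rotated polynomial is the eigenfunction, but G itself is the one invariant in the last
  -- variables. `xiSq` and `excess` do not distinguish the two.
  have hE : IsEig Polynomial.X η (perm τ G) := by
    have := hF.eig.rotate m hmn
    simp only [hνl] at this
    exact this
  have hGinv : ∀ σ : Equiv.Perm (Fin (n + 1)), (∀ i : Fin (n + 1), (i : ℕ) < m → σ i = i) →
      perm σ G = G := fun σ hσ => by
    rw [hG, map_mul, perm_leadProd hσ, hF.symm σ hσ]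
  have hGsupp : ∀ κ t, coeff κ G ≠ 0 → excess t κ ≤ (lam.parts.map (· - t)).sum := fun κ t hκ => by
    have h1 : coeff (Finsupp.equivMapDomain τ κ) (perm τ G) = coeff κ G := by
      rw [coeff_perm, ← Finsupp.equivMapDomain_trans]
      simp
    have h2 := hE.excess_le t (by rwa [h1])
    rw [hη, excess_comp_equiv, excess_part lam hmn] at h2
    refine le_trans (le_of_eq ?_) h2
    rw [← excess_comp_equiv t (Finsupp.equivMapDomain τ κ) τ]
    congr 1
    ext i
    simp
  set e : Polynomial ℤ := ∑ i, (Polynomial.X * (η i : Polynomial ℤ) - (rk η i : Polynomial ℤ)) ^ 2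
    with he
  have hGeig : xiSq Polynomial.X G = C e * G := by
    have h1 := hE.xiSq_eq
    rw [← perm_xiSq, ← he] at h1
    have h2 := congrArg (perm τ⁻¹) h1
    rwa [map_mul (perm τ⁻¹) (C e), rename_C, ← perm_mul, ← perm_mul, inv_mul_cancel, perm_one,
      perm_one] at h2
  refine ⟨symmetrize m G, e, fun σ => perm_symmetrize hGinv σ, ?_, ?_, ?_, ?_, ?_⟩
  · refine IsHomogeneous.sum _ _ _ fun ι _ => IsHomogeneous.rename_isHomogeneous ?_
    rw [← Nat.add_sub_cancel' hmN]
    refine IsHomogeneous.mul ?_ (hνsum ▸ hF.homog)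
    rw [leadProd_eq]
    refine isHomogeneous_monomial _ ?_
    rw [Finsupp.degree_eq_sum, sum_leadExp hmn]
  · intro d hd hdN
    set T := Finset.univ.filter fun i => d i = 1 with hT
    have hTcard : T.card = N := by
      rw [← hdN, Finset.card_eq_sum_ones, hT, Finset.sum_filter]
      refine Finset.sum_congr rfl fun i _ => ?_
      have := hd i
      split_ifs <;> omega
    have key : ∀ ι : {i : Fin (n + 1) // (i : ℕ) < m} ↪ Fin (n + 1),
        coeff d (perm (extendPerm ι) G) =
          if ∀ k, ι k ∈ T then ((N - m).factorial : Polynomial ℤ) else 0 := fun ι => by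
      rw [coeff_perm, hG, leadProd_eq, coeff_monomial_mul']
      set d' := Finsupp.equivMapDomain (extendPerm ι).symm d with hd'
      have hd'a : ∀ i, d' i = d (extendPerm ι i) := fun i => by simp [hd']
      have hiff : leadExp n m ≤ d' ↔ ∀ k, ι k ∈ T := by
        rw [Finsupp.le_def]
        constructor
        · intro h k
          have h1 := h k.1
          rw [leadExp_apply, if_pos k.2, hd'a, extendPerm_apply ι _ k.2] at h1
          have h2 := hd (ι k)
          simp only [hT, Finset.mem_filter, Finset.mem_univ, true_and]
          exact le_antisymm h2 h1
        · intro h i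
          rw [leadExp_apply]
          split_ifs with hi
          · have := h ⟨i, hi⟩
            simp only [hT, Finset.mem_filter, Finset.mem_univ, true_and] at this
            rw [hd'a, extendPerm_apply ι _ hi, this]
          · exact Nat.zero_le _
      by_cases hle : leadExp n m ≤ d'
      · rw [if_pos hle, if_pos (hiff.mp hle), one_mul]
        have h3 := hF.coeff_eq (d' - leadExp n m) (fun i => by
          rw [Finsupp.tsub_apply, hd'a]
          have := hd (extendPerm ι i)
          omega) (fun i hi => by
          rw [Finsupp.tsub_apply, hd'a, leadExp_apply, if_pos hi]
          have := hd (extendPerm ι i)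
          omega) (by
          have h4 : ∑ i, d' i = N := by
            rw [← hdN, ← Equiv.sum_comp (extendPerm ι) d]
            exact Finset.sum_congr rfl fun i _ => hd'a i
          have h5 : ∑ i, (d' - leadExp n m + leadExp n m) i = N := by
            rw [tsub_add_cancel_of_le hle, h4]
          simp only [Finsupp.add_apply, Finset.sum_add_distrib, sum_leadExp hmn] at h5
          rw [hνsum]; omega)
        rw [h3, hνsum]
      · rw [if_neg hle, if_neg (fun h => hle (hiff.mpr h))]
    -- A nonzero contribution is (N − m)! and requires the injection to land in the N-element
    -- support; there are N!/(N − m)! such injections, so the total is N!.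
    unfold symmetrize
    rw [coeff_sum, Finset.sum_congr rfl fun ι _ => key ι, ← Finset.sum_filter, Finset.sum_const,
      card_embedding_filter, hTcard, nsmul_eq_mul, ← Nat.cast_mul]
    congr 1
    have : Fintype.card {i : Fin (n + 1) // (i : ℕ) < m} = m := by
      rw [Fintype.card_subtype, Fin.card_filter_val_lt, min_eq_right hmn]
    rw [this, mul_comm, Nat.factorial_mul_descFactorial hmN]
  · intro κ mu hκ hne
    refine domLE_of_excess fun t => ?_
    rw [← excess_eq_of_vals hκ t]
    unfold symmetrize at hne
    rw [coeff_sum] at hne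
    obtain ⟨ι, -, hι⟩ := Finset.exists_ne_zero_of_sum_ne_zero hne
    rw [coeff_perm] at hι
    refine le_trans (le_of_eq ?_) (hGsupp _ t hι)
    rw [← excess_comp_equiv t κ (extendPerm ι)]
    congr 1
  · unfold symmetrize
    rw [map_sum, Finset.mul_sum]
    refine Finset.sum_congr rfl fun ι _ => ?_
    rw [← perm_xiSq, hGeig, map_mul (perm _) (C e), rename_C]
  · rw [he, coeff_one_eigenvalue, Finset.sum_range (fun i => i * part lam i),
      ← Equiv.sum_comp τ fun i => rk η i * η i]
    congr 2
    refine Finset.sum_congr rfl fun i _ => ?_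
    have hητ : ∀ j, η (τ j) = part lam j := fun j => by simp [hη]
    rw [hητ]
    -- On the first m indices the rotation is a translation, so it keeps the order of equal parts
    -- and the rank stays i. The remaining entries are zero, so their ranks are irrelevant.
    rcases lt_or_ge (i : ℕ) m with hi | hi
    · congr 1
      unfold rk
      have hcard : (Finset.univ.filter fun j : Fin (n + 1) => (j : ℕ) < i).card = i := by
        rw [Fin.card_filter_val_lt, min_eq_right i.isLt.le]
      conv_rhs => rw [← hcard]
      symm
      refine Finset.card_equiv τ fun j => ?_
      simp only [Finset.mem_filter, Finset.mem_univ, true_and, hητ, Fin.lt_def]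
      rw [hτ, rot_pow_val m hmn, rot_pow_val m hmn, if_pos hi]
      have hpi := (part_pos_iff lam i).mpr hi
      have hpj := part_pos_iff lam j
      have hanti := @part_antitone N lam
      constructor
      · intro hji
        have := hanti hji.le
        rw [if_pos (hji.trans hi)]
        omega
      · rintro (h | ⟨h1, h2⟩)
        · by_contra! h'
          have := hanti h'
          omega
        · rw [if_pos (by omega)] at h2
          omega
    · have : part lam i = 0 := by
        have := part_pos_iff lam i
        omega
      rw [this, mul_zero, mul_zero]

/-! ### The operator `xiSq` on polynomials in the power sums. -/

section PowerSums

variable {n : ℕ} {R : Type*} [CommRing R]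

lemma theta_X_pow (i : Fin n) (k : ℕ) :
    theta i (X i ^ k : MvPolynomial (Fin n) R) = (k : MvPolynomial (Fin n) R) * X i ^ k := by
  induction k with
  | zero => simp [theta_apply]
  | succ k ih => rw [pow_succ, theta_mul, ih, theta_X_self]; push_cast; ring

lemma theta_X_pow_of_ne {i j : Fin n} (h : j ≠ i) (k : ℕ) :
    theta i (X j ^ k : MvPolynomial (Fin n) R) = 0 := by
  induction k with
  | zero => simp [theta_apply]
  | succ k ih => rw [pow_succ, theta_mul, ih, theta_X_of_ne h]; ring

lemma theta_psum (i : Fin n) (k : ℕ) :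
    theta i (psum (Fin n) R k) = (k : MvPolynomial (Fin n) R) * X i ^ k := by
  rw [psum, map_sum, Finset.sum_eq_single i, theta_X_pow]
  · intro j _ hj; exact theta_X_pow_of_ne hj k
  · simp

/-- The homomorphism sending the `b`-th variable to the power sum of degree `b + 1`. -/
noncomputable def psumHom (n N : ℕ) (R : Type*) [CommRing R] :
    MvPolynomial (Fin N) R →ₐ[R] MvPolynomial (Fin n) R :=
  aeval fun b => psum (Fin n) R (b + 1)

lemma psumHom_X {N : ℕ} (b : Fin N) : psumHom n N R (X b) = psum (Fin n) R (b + 1) := by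
  simp [psumHom]

lemma perm_psumHom {N : ℕ} (σ : Equiv.Perm (Fin n)) (g : MvPolynomial (Fin N) R) :
    perm σ (psumHom n N R g) = psumHom n N R g := by
  have : (perm σ).comp (psumHom n N R) = psumHom n N R := by
    ext b : 1
    rw [AlgHom.comp_apply, psumHom_X, rename_psum]
  exact DFunLike.congr_fun this g

lemma theta_psumHom {N : ℕ} (i : Fin n) (g : MvPolynomial (Fin N) R) :
    theta i (psumHom n N R g) =
      ∑ b : Fin N, psumHom n N R (pderiv b g) * (((b + 1 : ℕ) : MvPolynomial (Fin n) R)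
        * X i ^ (b + 1 : ℕ)) := by
  induction g using MvPolynomial.induction_on with
  | C c =>
    simp [psumHom, theta_apply]
  | add p q hp hq => simp only [map_add, hp, hq, add_mul, Finset.sum_add_distrib]
  | mul_X p c hp =>
    rw [map_mul, theta_mul, hp, psumHom_X, theta_psum, Finset.sum_mul]
    have : ∀ b : Fin N, psumHom n N R (pderiv b (p * X c)) * (((b + 1 : ℕ) : MvPolynomial (Fin n) R)
        * X i ^ (b + 1 : ℕ)) = psumHom n N R (pderiv b p) * (((b + 1 : ℕ) : MvPolynomial (Fin n) R)
        * X i ^ (b + 1 : ℕ)) * psum (Fin n) R (c + 1) + if b = c then psumHom n N R p *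
          (((c + 1 : ℕ) : MvPolynomial (Fin n) R) * X i ^ (c + 1 : ℕ)) else 0 := fun b => by
      rw [pderiv_mul, map_add, map_mul, psumHom_X]
      split_ifs with h
      · subst h
        rw [pderiv_X_self, mul_one]; ring
      · rw [pderiv_X_of_ne (Ne.symm h), mul_zero, map_zero]; ring
    rw [Finset.sum_congr rfl fun b _ => this b, Finset.sum_add_distrib]
    simp

lemma theta_psumHom_mul {N : ℕ} (i : Fin n) (b : ℕ) (p : MvPolynomial (Fin N) R) :
    theta i (psumHom n N R p * (((b + 1 : ℕ) : MvPolynomial (Fin n) R) * X i ^ (b + 1 : ℕ))) =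
      ((b + 1 : ℕ) : MvPolynomial (Fin n) R) ^ 2 * X i ^ (b + 1 : ℕ) * psumHom n N R p +
      ∑ c : Fin N, ((b + 1 : ℕ) : MvPolynomial (Fin n) R) *
        ((c + 1 : ℕ) : MvPolynomial (Fin n) R) * X i ^ ((b + 1) + (c + 1) : ℕ) *
          psumHom n N R (pderiv c p) := by
  generalize b + 1 = k
  have hn : theta i ((k : MvPolynomial (Fin n) R) * X i ^ k)
      = (k : MvPolynomial (Fin n) R) * ((k : MvPolynomial (Fin n) R) * X i ^ k) := by
    rw [← nsmul_eq_mul, map_nsmul, theta_X_pow, nsmul_eq_mul, nsmul_eq_mul]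
  rw [theta_mul, theta_psumHom, hn, Finset.sum_mul, add_comm]
  refine congrArg₂ (· + ·) ?_ ?_
  · ring
  · refine Finset.sum_congr rfl fun c _ => ?_
    rw [pow_add (X i) k]
    ac_rfl

/-- The chain rule applied twice: second derivatives in the power sums join p_b and p_c to p_{b+c},
first derivatives keep the degree. -/
lemma sum_theta_sq_psumHom {N : ℕ} (g : MvPolynomial (Fin N) R) :
    ∑ i, theta i (theta i (psumHom n N R g)) =
      ∑ b : Fin N, ((b + 1 : ℕ) : MvPolynomial (Fin n) R) ^ 2 * psum (Fin n) R (b + 1) *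
        psumHom n N R (pderiv b g) +
      ∑ b : Fin N, ∑ c : Fin N, ((b + 1 : ℕ) : MvPolynomial (Fin n) R) *
        ((c + 1 : ℕ) : MvPolynomial (Fin n) R) * psum (Fin n) R ((b + 1) + (c + 1)) *
          psumHom n N R (pderiv c (pderiv b g)) := by
  have h1 : ∀ i : Fin n, theta i (theta i (psumHom n N R g)) =
      ∑ b : Fin N, (((b + 1 : ℕ) : MvPolynomial (Fin n) R) ^ 2 * X i ^ (b + 1 : ℕ) *
        psumHom n N R (pderiv b g) + ∑ c : Fin N, ((b + 1 : ℕ) : MvPolynomial (Fin n) R) *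
        ((c + 1 : ℕ) : MvPolynomial (Fin n) R) * X i ^ ((b + 1) + (c + 1) : ℕ) *
          psumHom n N R (pderiv c (pderiv b g))) := fun i => by
    rw [theta_psumHom, map_sum]
    exact Finset.sum_congr rfl fun b _ => theta_psumHom_mul i b _
  rw [Finset.sum_congr rfl fun i _ => h1 i, Finset.sum_comm, ← Finset.sum_add_distrib]
  refine Finset.sum_congr rfl fun b _ => ?_
  rw [Finset.sum_add_distrib]
  congr 1
  · rw [psum, Finset.mul_sum, Finset.sum_mul]
  · rw [Finset.sum_comm]
    refine Finset.sum_congr rfl fun c _ => ?_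
    rw [psum, Finset.mul_sum, Finset.sum_mul]

variable [IsDomain R]

lemma dd_mul_of_symm {i j : Fin n} {s : MvPolynomial (Fin n) R}
    (hs : perm (Equiv.swap i j) s = s) (h : MvPolynomial (Fin n) R) :
    dd i j (s * h) = s * dd i j h := by
  rcases eq_or_ne i j with rfl | hij
  · simp
  · refine (eq_dd hij ?_).symm
    rw [map_mul, hs]
    linear_combination s * dd_spec i j h

lemma X_left_mul_dd_X_pow {i j : Fin n} (h : i ≠ j) (m : ℕ) :
    X i * dd i j (X i ^ (m + 1) : MvPolynomial (Fin n) R) =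
      ∑ u ∈ Finset.range m, X i ^ (u + 1) * X j ^ (m - u) + X i ^ (m + 1) := by
  have := dd_X_pow_mul (R := R) h (m + 1) (g := 1) (map_one _)
  simp only [mul_one] at this
  rw [this, Finset.mul_sum, Finset.sum_range_succ]
  congr 1
  · refine Finset.sum_congr rfl fun u _ => ?_
    rw [Nat.add_sub_cancel]; ring
  · simp; ring

lemma X_right_mul_dd_X_pow {i j : Fin n} (h : i ≠ j) (m : ℕ) :
    X j * dd i j (X i ^ (m + 1) : MvPolynomial (Fin n) R) =
      ∑ u ∈ Finset.range m, X i ^ (u + 1) * X j ^ (m - u) + X j ^ (m + 1) := by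
  have := dd_X_pow_mul (R := R) h (m + 1) (g := 1) (map_one _)
  simp only [mul_one] at this
  rw [this, Finset.mul_sum, Finset.sum_range_succ']
  congr 1
  · refine Finset.sum_congr rfl fun u hu => ?_
    have hu' := Finset.mem_range.mp hu
    rw [Nat.add_sub_cancel, show m - u = m - (u + 1) + 1 by omega]; ring
  · simp; ring

/-- The sum over u is written for all pairs, diagonal included and subtracted, so that summation
over i and j yields products of power sums. The leftover term is always the power of the variable
with the larger index. -/
lemma X_max_mul_dd_X_pow (i j : Fin n) (m : ℕ) :
    X (max i j) * dd i j (X i ^ (m + 1) : MvPolynomial (Fin n) R) =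
      (∑ u ∈ Finset.range m, (X i ^ (u + 1) * X j ^ (m - u)
        - if j = i then X i ^ (m + 1) else 0)) +
      ((if j < i then X i ^ (m + 1) else 0) + if i < j then X j ^ (m + 1) else 0) := by
  rcases lt_trichotomy i j with h | rfl | h
  · rw [max_eq_right h.le, X_right_mul_dd_X_pow h.ne]
    simp [h, h.ne', h.not_gt]
  · rw [dd_self]
    symm
    rw [mul_zero]
    simp only [lt_irrefl, if_false, add_zero, if_true]
    refine Finset.sum_eq_zero fun u hu => ?_
    have hu' := Finset.mem_range.mp hu
    rw [← pow_add, show u + 1 + (m - u) = m + 1 by omega, sub_self]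
  · rw [max_eq_left h.le, X_left_mul_dd_X_pow h.ne']
    simp [h, h.ne, h.not_gt]

lemma sum_X_max_mul_dd_X_pow (m : ℕ) :
    ∑ i : Fin n, ∑ j : Fin n, X (max i j) * dd i j (X i ^ (m + 1) : MvPolynomial (Fin n) R) =
      ∑ u ∈ Finset.range m, (psum (Fin n) R (u + 1) * psum (Fin n) R (m - u)
        - psum (Fin n) R (m + 1)) +
      2 * ∑ i : Fin n, ((i : ℕ) : MvPolynomial (Fin n) R) * X i ^ (m + 1) := by
  simp only [X_max_mul_dd_X_pow, Finset.sum_add_distrib]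
  congr 1
  · rw [Finset.sum_congr rfl fun i _ => Finset.sum_comm, Finset.sum_comm]
    refine Finset.sum_congr rfl fun u _ => ?_
    simp only [Finset.sum_sub_distrib, Finset.sum_ite_eq', Finset.mem_univ, if_true]
    rw [psum, psum, psum, Finset.sum_mul_sum]
  · have h1 : ∀ i : Fin n, ∑ j : Fin n, (if j < i then X i ^ (m + 1) else 0 :
        MvPolynomial (Fin n) R) = ((i : ℕ) : MvPolynomial (Fin n) R) * X i ^ (m + 1) := fun i => by
      rw [← Finset.sum_filter, Finset.sum_const, nsmul_eq_mul, Finset.filter_gt_eq_Iio,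
        Fin.card_Iio]
    rw [two_mul]
    congr 1
    · exact Finset.sum_congr rfl fun i _ => h1 i
    · rw [Finset.sum_comm]
      exact Finset.sum_congr rfl fun i _ => h1 i

lemma xi_of_symm (a : R) {f : MvPolynomial (Fin n) R} (hf : ∀ σ, perm σ f = f) (i : Fin n) :
    xi a i f = C a * theta i f - ((i : ℕ) : MvPolynomial (Fin n) R) * f := by
  rw [xi_apply, Finset.sum_eq_zero fun j _ => by rw [dd_of_symm i j (hf _), mul_zero], add_zero]

/-- On symmetric polynomials the divided differences vanish in the first application of ξ_i. In the
second, the terms 2 ∑ i x_i^{b+1} from `sum_X_max_mul_dd_X_pow` cancel the cross terms −2 i θ_i,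
leaving a symmetric expression. -/
lemma xiSq_psumHom {N : ℕ} (a : R) (g : MvPolynomial (Fin N) R) :
    xiSq a (psumHom n N R g) = C a ^ 2 * ∑ i, theta i (theta i (psumHom n N R g)) +
      C a * ∑ b : Fin N, ((b + 1 : ℕ) : MvPolynomial (Fin n) R) * psumHom n N R (pderiv b g) *
        ∑ u ∈ Finset.range b, (psum (Fin n) R (u + 1) * psum (Fin n) R (b - u)
          - psum (Fin n) R (b + 1)) +
      (∑ i : Fin n, ((i : ℕ) : MvPolynomial (Fin n) R) ^ 2) * psumHom n N R g := by
  set f := psumHom n N R g with hf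
  have hn : ∀ (i : Fin n) (k : ℕ) (f : MvPolynomial (Fin n) R),
      xi a i ((k : MvPolynomial (Fin n) R) * f) = (k : MvPolynomial (Fin n) R) * xi a i f :=
    fun i k f => by rw [← nsmul_eq_mul, map_nsmul, nsmul_eq_mul]
  have h1 : ∀ i, xi a i (xi a i f) = C a ^ 2 * theta i (theta i f) +
      C a * (∑ j, X (max i j) * dd i j (theta i f)
        - 2 * (((i : ℕ) : MvPolynomial (Fin n) R) * theta i f)) +
      ((i : ℕ) : MvPolynomial (Fin n) R) ^ 2 * f := fun i => by
    rw [xi_of_symm a (fun σ => perm_psumHom σ g), map_sub, xi_C_mul, hn,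
      xi_of_symm a (fun σ => perm_psumHom σ g), xi_apply]
    ring
  rw [xiSq_apply, Finset.sum_congr rfl fun i _ => h1 i, Finset.sum_add_distrib,
    Finset.sum_add_distrib, ← Finset.mul_sum, ← Finset.mul_sum, ← Finset.sum_mul]
  congr 3
  have h2 : ∀ i j, X (max i j) * dd i j (theta i f) = ∑ b : Fin N,
      ((b + 1 : ℕ) : MvPolynomial (Fin n) R) * psumHom n N R (pderiv b g) *
        (X (max i j) * dd i j (X i ^ (b + 1 : ℕ))) := fun i j => by
    rw [hf, theta_psumHom, map_sum, Finset.mul_sum]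
    refine Finset.sum_congr rfl fun b _ => ?_
    rw [← mul_assoc (psumHom n N R (pderiv b g)), dd_mul_of_symm (by
      rw [map_mul, perm_psumHom, map_natCast])]
    ring
  have h3 : ∀ i : Fin n, ((i : ℕ) : MvPolynomial (Fin n) R) * theta i f = ∑ b : Fin N,
      ((b + 1 : ℕ) : MvPolynomial (Fin n) R) * psumHom n N R (pderiv b g) *
        (((i : ℕ) : MvPolynomial (Fin n) R) * X i ^ (b + 1 : ℕ)) := fun i => by
    rw [hf, theta_psumHom, Finset.mul_sum]
    exact Finset.sum_congr rfl fun b _ => by ring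
  have h4 : ∑ i : Fin n, ∑ j : Fin n, X (max i j) * dd i j (theta i f) = ∑ b : Fin N,
      ((b + 1 : ℕ) : MvPolynomial (Fin n) R) * psumHom n N R (pderiv b g) *
        ∑ i : Fin n, ∑ j : Fin n, X (max i j) * dd i j (X i ^ (b + 1 : ℕ)) := by
    simp only [h2, Finset.mul_sum]
    rw [Finset.sum_congr rfl fun i _ => Finset.sum_comm, Finset.sum_comm]
  have h5 : ∑ i : Fin n, ((i : ℕ) : MvPolynomial (Fin n) R) * theta i f = ∑ b : Fin N,
      ((b + 1 : ℕ) : MvPolynomial (Fin n) R) * psumHom n N R (pderiv b g) *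
        ∑ i : Fin n, ((i : ℕ) : MvPolynomial (Fin n) R) * X i ^ (b + 1 : ℕ) := by
    simp only [h3, Finset.mul_sum]
    rw [Finset.sum_comm]
  rw [Finset.sum_sub_distrib, ← Finset.mul_sum, h4, h5, Finset.mul_sum, ← Finset.sum_sub_distrib]
  refine Finset.sum_congr rfl fun b _ => ?_
  rw [sum_X_max_mul_dd_X_pow]
  ring

end PowerSums

/-! ### The scalar product on power sums and self-adjointness. -/

section PowerSumForm

variable {N : ℕ} {R : Type*} [CommRing R] (a : R)

/-- The squared norm of a monomial in the power sums. -/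
noncomputable def normWeight (u : Fin N →₀ ℕ) : R :=
  ∏ b : Fin N, ((u b).factorial : R) * (a * ((b + 1 : ℕ) : R)) ^ u b

lemma normWeight_add_single (u : Fin N →₀ ℕ) (b : Fin N) :
    normWeight a (u + Finsupp.single b 1) =
      normWeight a u * ((u b : R) + 1) * (a * ((b + 1 : ℕ) : R)) := by
  unfold normWeight
  rw [← Finset.mul_prod_erase _ _ (Finset.mem_univ b), ← Finset.mul_prod_erase Finset.univ
    (fun b : Fin N => ((u b).factorial : R) * (a * ((b + 1 : ℕ) : R)) ^ u b) (Finset.mem_univ b)]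
  have : ∀ c ∈ Finset.univ.erase b, (((u + Finsupp.single b 1 : Fin N →₀ ℕ) c).factorial : R) *
      (a * ((c + 1 : ℕ) : R)) ^ ((u + Finsupp.single b 1 : Fin N →₀ ℕ) c) =
      ((u c).factorial : R) * (a * ((c + 1 : ℕ) : R)) ^ u c := fun c hc => by
    have : (u + Finsupp.single b 1 : Fin N →₀ ℕ) c = u c := by
      simp [(Finset.ne_of_mem_erase hc).symm]
    rw [this]
  rw [Finset.prod_congr rfl this]
  have hb : (u + Finsupp.single b 1 : Fin N →₀ ℕ) b = u b + 1 := by simp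
  rw [hb, Nat.factorial_succ, pow_succ]
  push_cast
  ring

/-- The bilinear form for which the monomials in the power sums are orthogonal. -/
noncomputable def psForm : MvPolynomial (Fin N) R →ₗ[R] MvPolynomial (Fin N) R →ₗ[R] R :=
  (basisMonomials (Fin N) R).constr R fun u => normWeight a u • lcoeff R u

lemma psForm_monomial (u : Fin N →₀ ℕ) (c : R) (g : MvPolynomial (Fin N) R) :
    psForm a (monomial u c) g = c * (normWeight a u * coeff u g) := by
  have h1 : (monomial u c : MvPolynomial (Fin N) R) = c • basisMonomials (Fin N) R u := by
    simp [smul_monomial]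
  rw [h1, map_smul, psForm, Module.Basis.constr_basis]
  simp

lemma psForm_comm (f g : MvPolynomial (Fin N) R) : psForm a f g = psForm a g f := by
  induction f using MvPolynomial.induction_on' with
  | add p q hp hq => rw [map_add, map_add, LinearMap.add_apply, hp, hq]
  | monomial u c =>
    induction g using MvPolynomial.induction_on' with
    | add p q hp hq => rw [map_add, map_add, LinearMap.add_apply, hp, hq]
    | monomial v d =>
      rw [psForm_monomial, psForm_monomial, coeff_monomial, coeff_monomial]
      by_cases h : u = v
      · subst h; simp; ring
      · rw [if_neg h, if_neg (Ne.symm h)]; simp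

/-- Multiplication by a variable. -/
noncomputable def mulVar (R : Type*) [CommRing R] (b : Fin N) :
    MvPolynomial (Fin N) R →ₗ[R] MvPolynomial (Fin N) R := LinearMap.mulLeft R (X b)

/-- The derivation adjoint to `mulVar`. -/
noncomputable def adjVar (b : Fin N) : MvPolynomial (Fin N) R →ₗ[R] MvPolynomial (Fin N) R :=
  (a * ((b + 1 : ℕ) : R)) • (pderiv b).toLinearMap

lemma mulVar_apply (b : Fin N) (f : MvPolynomial (Fin N) R) : mulVar R b f = X b * f := rfl

lemma adjVar_apply (b : Fin N) (f : MvPolynomial (Fin N) R) :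
    adjVar a b f = C (a * ((b + 1 : ℕ) : R)) * pderiv b f := by
  rw [adjVar, LinearMap.smul_apply, smul_eq_C_mul]; rfl

lemma psForm_mulVar (b : Fin N) (f g : MvPolynomial (Fin N) R) :
    psForm a (mulVar R b f) g = psForm a f (adjVar a b g) := by
  induction f using MvPolynomial.induction_on' with
  | add p q hp hq => simp only [map_add, LinearMap.add_apply, hp, hq]
  | monomial u c =>
    have : mulVar R b (monomial u c) = monomial (u + Finsupp.single b 1) c := by
      rw [mulVar_apply, X, monomial_mul, one_mul, add_comm]
    rw [this, psForm_monomial, psForm_monomial, adjVar_apply, coeff_C_mul, coeff_pderiv,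
      normWeight_add_single]
    ring

lemma psForm_adjVar (b : Fin N) (f g : MvPolynomial (Fin N) R) :
    psForm a (adjVar a b f) g = psForm a f (mulVar R b g) := by
  rw [psForm_comm, ← psForm_mulVar, psForm_comm]

/-- The operator on polynomials in the power sums which corresponds to `xiSq`. -/
noncomputable def psOp (c₀ : R) : MvPolynomial (Fin N) R →ₗ[R] MvPolynomial (Fin N) R :=
  ∑ b : Fin N, (a * ((b + 1 : ℕ) : R) - ((b : ℕ) : R)) • (mulVar R b ∘ₗ adjVar a b) +
  c₀ • LinearMap.id +
  ∑ b : Fin N, ∑ c : Fin N, ∑ e : Fin N, if (b : ℕ) + c + 1 = e then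
    (mulVar R e ∘ₗ adjVar a c ∘ₗ adjVar a b + mulVar R b ∘ₗ mulVar R c ∘ₗ adjVar a e) else 0

/-- Joining p_b, p_c into p_e and splitting p_e into p_b, p_c are adjoint to each other, so their
sum is self-adjoint. -/
lemma psForm_join_split (b c e : Fin N) (f g : MvPolynomial (Fin N) R) :
    psForm a ((mulVar R e ∘ₗ adjVar a c ∘ₗ adjVar a b + mulVar R b ∘ₗ mulVar R c ∘ₗ adjVar a e) f) g
      = psForm a f
        ((mulVar R e ∘ₗ adjVar a c ∘ₗ adjVar a b + mulVar R b ∘ₗ mulVar R c ∘ₗ adjVar a e) g) := by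
  have h1 : psForm a (mulVar R e (adjVar a c (adjVar a b f))) g =
      psForm a f (mulVar R b (mulVar R c (adjVar a e g))) := by
    rw [psForm_mulVar, psForm_adjVar, psForm_adjVar]
  have h2 : psForm a (mulVar R b (mulVar R c (adjVar a e f))) g =
      psForm a f (mulVar R e (adjVar a c (adjVar a b g))) := by
    rw [psForm_mulVar, psForm_mulVar, psForm_adjVar]
  rw [LinearMap.add_apply, LinearMap.add_apply, map_add, map_add, LinearMap.add_apply, add_comm]
  exact congrArg₂ (· + ·) h2 h1

lemma psForm_psOp (c₀ : R) (f g : MvPolynomial (Fin N) R) :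
    psForm a (psOp a c₀ f) g = psForm a f (psOp a c₀ g) := by
  have h1 : ∀ b : Fin N, psForm a (((a * ((b + 1 : ℕ) : R) - ((b : ℕ) : R)) •
      (mulVar R b ∘ₗ adjVar a b)) f) g = psForm a f (((a * ((b + 1 : ℕ) : R) - ((b : ℕ) : R)) •
      (mulVar R b ∘ₗ adjVar a b)) g) := fun b => by
    rw [LinearMap.smul_apply, LinearMap.smul_apply, LinearMap.comp_apply, LinearMap.comp_apply,
      map_smul, map_smul, LinearMap.smul_apply, psForm_mulVar, psForm_adjVar]
  have h2 : psForm a ((c₀ • LinearMap.id : MvPolynomial (Fin N) R →ₗ[R] _) f) g =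
      psForm a f ((c₀ • LinearMap.id : MvPolynomial (Fin N) R →ₗ[R] _) g) := by
    rw [LinearMap.smul_apply, LinearMap.smul_apply, LinearMap.id_apply, LinearMap.id_apply,
      map_smul, map_smul, LinearMap.smul_apply]
  have h3 : ∀ b c e : Fin N, psForm a ((if (b : ℕ) + c + 1 = e then
      (mulVar R e ∘ₗ adjVar a c ∘ₗ adjVar a b + mulVar R b ∘ₗ mulVar R c ∘ₗ adjVar a e) else 0 :
        MvPolynomial (Fin N) R →ₗ[R] _) f) g = psForm a f ((if (b : ℕ) + c + 1 = e then
      (mulVar R e ∘ₗ adjVar a c ∘ₗ adjVar a b + mulVar R b ∘ₗ mulVar R c ∘ₗ adjVar a e) else 0 :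
        MvPolynomial (Fin N) R →ₗ[R] _) g) := fun b c e => by
    split_ifs
    · exact psForm_join_split a b c e f g
    · simp
  simp only [psOp, LinearMap.add_apply, LinearMap.sum_apply, map_add, map_sum, h1, h2, h3]

/-- The degrees of the power sums. -/
def psWeight (N : ℕ) (b : Fin N) : ℕ := b + 1

lemma mulVar_isWeightedHomogeneous {f : MvPolynomial (Fin N) R} {k l : ℕ}
    (hf : IsWeightedHomogeneous (psWeight N) f k) (b : Fin N) (h : k + (b + 1) = l) :
    IsWeightedHomogeneous (psWeight N) (mulVar R b f) l := by
  have := (isWeightedHomogeneous_X R (psWeight N) b).mul hf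
  rwa [show psWeight N b + k = l by rw [psWeight]; omega] at this

lemma adjVar_isWeightedHomogeneous {f : MvPolynomial (Fin N) R} {k l : ℕ}
    (hf : IsWeightedHomogeneous (psWeight N) f k) (b : Fin N) (h : l + (b + 1) = k) :
    IsWeightedHomogeneous (psWeight N) (adjVar a b f) l := by
  rw [adjVar_apply]
  exact (hf.pderiv (i := b) h).C_mul _

/-- Used to stay in weight N, where `psumHom` is injective. -/
lemma psOp_isWeightedHomogeneous (c₀ : R) {f : MvPolynomial (Fin N) R}
    (hf : IsWeightedHomogeneous (psWeight N) f N) :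
    IsWeightedHomogeneous (psWeight N) (psOp a c₀ f) N := by
  simp only [psOp, LinearMap.add_apply, LinearMap.sum_apply]
  refine (IsWeightedHomogeneous.add ?_ ?_).add ?_
  · refine IsWeightedHomogeneous.sum _ _ _ fun b _ => ?_
    rw [LinearMap.smul_apply, smul_eq_C_mul]
    refine IsWeightedHomogeneous.C_mul ?_ _
    exact mulVar_isWeightedHomogeneous
      (adjVar_isWeightedHomogeneous a hf b (l := N - (b + 1)) (by omega)) b (by omega)
  · rw [LinearMap.smul_apply, smul_eq_C_mul]
    exact hf.C_mul _
  · refine IsWeightedHomogeneous.sum _ _ _ fun b _ => IsWeightedHomogeneous.sum _ _ _ fun c _ =>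
      IsWeightedHomogeneous.sum _ _ _ fun e _ => ?_
    split_ifs with h
    · refine IsWeightedHomogeneous.add ?_ ?_
      · exact mulVar_isWeightedHomogeneous (adjVar_isWeightedHomogeneous a
          (adjVar_isWeightedHomogeneous a hf b (l := N - (b + 1)) (by omega)) c
          (l := N - (e + 1)) (by omega)) e (by omega)
      · exact mulVar_isWeightedHomogeneous (mulVar_isWeightedHomogeneous
          (adjVar_isWeightedHomogeneous a hf e (l := N - (e + 1)) (by omega)) c
          (l := N - (b + 1)) (by omega)) b (by omega)
    · exact isWeightedHomogeneous_zero _ _ _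

/-- The two derivatives lower the weight by b + c + 2 > N. This is why only joins to some p_e with e
≤ N are needed in `psOp`. -/
lemma pderiv_pderiv_eq_zero {f : MvPolynomial (Fin N) R}
    (hf : IsWeightedHomogeneous (psWeight N) f N) {b c : Fin N} (h : N ≤ (b : ℕ) + c + 1) :
    pderiv c (pderiv b f) = 0 := by
  ext u
  rw [coeff_pderiv, coeff_pderiv, coeff_zero]
  have : coeff (u + Finsupp.single c 1 + Finsupp.single b 1) f = 0 := by
    refine hf.coeff_eq_zero _ fun hw => ?_
    rw [map_add, map_add, Finsupp.weight_single, Finsupp.weight_single] at hw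
    simp only [psWeight, smul_eq_mul, one_mul] at hw
    omega
  rw [this]; ring

lemma sum_range_eq_sum_fin {M : Type*} [AddCommMonoid M] (e : Fin N) (h : ℕ → ℕ → M) :
    ∑ u ∈ Finset.range e, h (u + 1) (e - u) =
      ∑ b : Fin N, ∑ c : Fin N, if (b : ℕ) + c + 1 = e then h (b + 1) (c + 1) else 0 := by
  have h1 : ∀ b : Fin N, (∑ c : Fin N, if (b : ℕ) + c + 1 = e then h (b + 1) (c + 1) else 0) =
      if (b : ℕ) < e then h (b + 1) (e - b) else 0 := fun b => by
    split_ifs with hb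
    · rw [Finset.sum_eq_single (⟨e - b - 1, by omega⟩ : Fin N)]
      · simp only
        rw [if_pos (by omega), show (e : ℕ) - b - 1 + 1 = e - b by omega]
      · intro c _ hc
        rw [if_neg]
        intro h'
        exact hc (Fin.ext (by simp; omega))
      · simp
    · exact Finset.sum_eq_zero fun c _ => if_neg (by omega)
  rw [Finset.sum_congr rfl fun b _ => h1 b,
    ← Finset.sum_range (fun b => if b < (e : ℕ) then h (b + 1) (e - b) else 0),
    ← Finset.sum_filter]
  congr 1
  ext b
  simp only [Finset.mem_range, Finset.mem_filter]
  omega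

lemma xiSq_psumHom_eq [IsDomain R] {n : ℕ} {g : MvPolynomial (Fin N) R}
    (hg : IsWeightedHomogeneous (psWeight N) g N) :
    xiSq a (psumHom n N R g) =
      psumHom n N R (psOp a (∑ i : Fin n, ((i : ℕ) : R) ^ 2) g) := by
  have hC : ∀ c : R, psumHom n N R (C c) = C c := fun c => by
    rw [psumHom, aeval_C]; rfl
  have hM : ∀ b f, psumHom n N R (mulVar R b f) = psum (Fin n) R (b + 1) * psumHom n N R f :=
    fun b f => by rw [mulVar_apply, map_mul, psumHom_X]
  have hA : ∀ b f, psumHom n N R (adjVar a b f) =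
      C a * ((b + 1 : ℕ) : MvPolynomial (Fin n) R) * psumHom n N R (pderiv b f) := fun b f => by
    rw [adjVar_apply, map_mul, hC, C_mul, map_natCast]
  have hAA : ∀ b c f, psumHom n N R (adjVar a c (adjVar a b f)) =
      C a ^ 2 * (((b + 1 : ℕ) : MvPolynomial (Fin n) R) * ((c + 1 : ℕ) : MvPolynomial (Fin n) R) *
        psumHom n N R (pderiv c (pderiv b f))) := fun b c f => by
    rw [hA, adjVar_apply, pderiv_C_mul, map_mul, hC, C_mul, map_natCast]
    ring
  have h2 : ∑ b : Fin N, ∑ c : Fin N, ((b + 1 : ℕ) : MvPolynomial (Fin n) R) *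
        ((c + 1 : ℕ) : MvPolynomial (Fin n) R) * psum (Fin n) R ((b + 1) + (c + 1)) *
          psumHom n N R (pderiv c (pderiv b g)) =
      ∑ b : Fin N, ∑ c : Fin N, ∑ e : Fin N, if (b : ℕ) + c + 1 = e then
        ((b + 1 : ℕ) : MvPolynomial (Fin n) R) *
        ((c + 1 : ℕ) : MvPolynomial (Fin n) R) * psum (Fin n) R (e + 1) *
          psumHom n N R (pderiv c (pderiv b g)) else 0 := by
    refine Finset.sum_congr rfl fun b _ => Finset.sum_congr rfl fun c _ => ?_
    by_cases h : (b : ℕ) + c + 1 < N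
    · rw [Finset.sum_eq_single (⟨b + c + 1, h⟩ : Fin N)]
      · simp only [if_true]
        rw [show (b : ℕ) + 1 + (c + 1) = b + c + 1 + 1 by omega]
      · intro e _ he
        rw [if_neg]
        exact fun h' => he (Fin.ext h'.symm)
      · simp
    · rw [pderiv_pderiv_eq_zero hg (by omega)]
      simp
  have h3 : ∀ e : Fin N, ∑ u ∈ Finset.range (e : ℕ), (psum (Fin n) R (u + 1) *
      psum (Fin n) R (e - u) - psum (Fin n) R (e + 1)) =
      (∑ b : Fin N, ∑ c : Fin N, if (b : ℕ) + c + 1 = e then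
        psum (Fin n) R (b + 1) * psum (Fin n) R (c + 1) else 0) -
      ((e : ℕ) : MvPolynomial (Fin n) R) * psum (Fin n) R (e + 1) := fun e => by
    rw [Finset.sum_sub_distrib, sum_range_eq_sum_fin e
      (fun x y => psum (Fin n) R x * psum (Fin n) R y), Finset.sum_const, Finset.card_range,
      nsmul_eq_mul]
  have h4 : ∑ e : Fin N, ((e + 1 : ℕ) : MvPolynomial (Fin n) R) * psumHom n N R (pderiv e g) *
      (∑ b : Fin N, ∑ c : Fin N, if (b : ℕ) + c + 1 = e then
        psum (Fin n) R (b + 1) * psum (Fin n) R (c + 1) else 0) =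
      ∑ b : Fin N, ∑ c : Fin N, ∑ e : Fin N, if (b : ℕ) + c + 1 = e then
        ((e + 1 : ℕ) : MvPolynomial (Fin n) R) * psumHom n N R (pderiv e g) *
        (psum (Fin n) R (b + 1) * psum (Fin n) R (c + 1)) else 0 := by
    simp only [Finset.mul_sum, mul_ite, mul_zero]
    rw [Finset.sum_comm]
    exact Finset.sum_congr rfl fun b _ => Finset.sum_comm
  rw [xiSq_psumHom, sum_theta_sq_psumHom, h2]
  simp only [h3, mul_sub, Finset.sum_sub_distrib]
  rw [h4]
  simp only [psOp, LinearMap.add_apply, LinearMap.sum_apply, map_add, map_sum,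
    LinearMap.smul_apply, LinearMap.comp_apply, LinearMap.id_apply, smul_eq_C_mul, map_mul, hC]
  have h5 : ∀ b c e : Fin N, psumHom n N R ((if (b : ℕ) + c + 1 = e then
      (mulVar R e ∘ₗ adjVar a c ∘ₗ adjVar a b + mulVar R b ∘ₗ mulVar R c ∘ₗ adjVar a e)
        else 0) g) =
      C a ^ 2 * (if (b : ℕ) + c + 1 = e then ((b + 1 : ℕ) : MvPolynomial (Fin n) R) *
        ((c + 1 : ℕ) : MvPolynomial (Fin n) R) * psum (Fin n) R (e + 1) *
          psumHom n N R (pderiv c (pderiv b g)) else 0) +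
      C a * (if (b : ℕ) + c + 1 = e then
        ((e + 1 : ℕ) : MvPolynomial (Fin n) R) * psumHom n N R (pderiv e g) *
        (psum (Fin n) R (b + 1) * psum (Fin n) R (c + 1)) else 0) := fun b c e => by
    split_ifs
    · simp only [LinearMap.add_apply, LinearMap.comp_apply, map_add, hM, hAA, hA]
      ring
    · simp
  simp only [h5, Finset.sum_add_distrib, ← Finset.mul_sum]
  have h6 : ∀ b : Fin N, C (a * ((b + 1 : ℕ) : R) - ((b : ℕ) : R)) *
      psumHom n N R (mulVar R b (adjVar a b g)) =
      C a ^ 2 * (((b + 1 : ℕ) : MvPolynomial (Fin n) R) ^ 2 * psum (Fin n) R (b + 1) *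
        psumHom n N R (pderiv b g)) -
      C a * (((b + 1 : ℕ) : MvPolynomial (Fin n) R) * psumHom n N R (pderiv b g) *
        (((b : ℕ) : MvPolynomial (Fin n) R) * psum (Fin n) R (b + 1))) := fun b => by
    rw [hM, hA, C_sub, C_mul, map_natCast, map_natCast]
    ring
  simp only [h6, Finset.sum_sub_distrib, ← Finset.mul_sum, map_pow, map_natCast]
  ring

end PowerSumForm

/-! ### Partitions of N as exponent vectors of weight N. -/

section PartitionExponents

variable {N : ℕ}

lemma prod_toFinset_eq_prod_fin {M : Type*} [CommMonoid M] (mu : N.Partition) (F : ℕ → M)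
    (hF : ∀ k, k ∉ mu.parts → F k = 1) :
    ∏ k ∈ mu.parts.toFinset, F k = ∏ b : Fin N, F (b + 1) := by
  classical
  have hinj : Function.Injective fun b : Fin N => (b : ℕ) + 1 := fun b c h => by
    apply Fin.ext; simpa using h
  rw [← Finset.prod_image (s := Finset.univ) (g := fun b : Fin N => (b : ℕ) + 1)
    fun b _ c _ h => hinj h]
  refine Finset.prod_subset (fun k hk => ?_) fun k _ hk => hF k (by simpa using hk)
  have hk' := Multiset.mem_toFinset.mp hk
  have h1 := mu.parts_pos hk'
  have h2 := Multiset.le_sum_of_mem hk'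
  rw [mu.parts_sum] at h2
  exact Finset.mem_image.mpr ⟨⟨k - 1, by omega⟩, Finset.mem_univ _, by simp; omega⟩

/-- The exponent vector of `p_μ` as a monomial in the power sums. -/
noncomputable def multExp (mu : N.Partition) : Fin N →₀ ℕ :=
  Finsupp.equivFunOnFinite.symm fun b => mu.parts.count (b + 1 : ℕ)

lemma multExp_apply (mu : N.Partition) (b : Fin N) :
    multExp mu b = mu.parts.count (b + 1 : ℕ) := rfl

lemma multExp_injective : Function.Injective (multExp : N.Partition → Fin N →₀ ℕ) := by
  intro mu nu h
  refine Nat.Partition.ext (Multiset.ext.mpr fun k => ?_)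
  by_cases hk : 1 ≤ k ∧ k ≤ N
  · have := DFunLike.congr_fun h (⟨k - 1, by omega⟩ : Fin N)
    simpa [multExp_apply, Nat.sub_add_cancel hk.1] using this
  · have hz : ∀ ρ : N.Partition, ρ.parts.count k = 0 := fun ρ => by
      refine Multiset.count_eq_zero_of_notMem fun hm => hk ⟨ρ.parts_pos hm, ?_⟩
      have := Multiset.le_sum_of_mem hm
      rwa [ρ.parts_sum] at this
    rw [hz, hz]

lemma weight_eq_sum (u : Fin N →₀ ℕ) : Finsupp.weight (psWeight N) u = ∑ b, u b * (b + 1) := by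
  rw [Finsupp.weight_apply, Finsupp.sum_fintype _ _ (by simp)]
  rfl

lemma weight_multExp (mu : N.Partition) : Finsupp.weight (psWeight N) (multExp mu) = N := by
  classical
  rw [weight_eq_sum]
  have h1 := Finset.sum_multiset_map_count mu.parts id
  rw [Multiset.map_id, mu.parts_sum] at h1
  have h2 := prod_toFinset_eq_prod_fin (M := Multiplicative ℕ) mu
    (fun k => Multiplicative.ofAdd (mu.parts.count k • k)) (fun k hk => by
      rw [Multiset.count_eq_zero_of_notMem hk, zero_smul]; rfl)
  rw [← ofAdd_sum, ← ofAdd_sum] at h2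
  have h3 := Multiplicative.ofAdd.injective h2
  exact (h1.trans h3).symm

lemma exists_multExp {u : Fin N →₀ ℕ} (hu : Finsupp.weight (psWeight N) u = N) :
    ∃ mu : N.Partition, multExp mu = u := by
  classical
  rw [weight_eq_sum] at hu
  refine ⟨{ parts := ∑ b : Fin N, Multiset.replicate (u b) ((b : ℕ) + 1), parts_pos := ?_,
            parts_sum := ?_ }, ?_⟩
  · intro k hk
    obtain ⟨b, -, hb⟩ := Multiset.mem_sum.mp hk
    rw [Multiset.eq_of_mem_replicate hb]; omega
  · rw [Multiset.sum_sum]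
    simpa using hu
  · ext b
    rw [multExp_apply, Multiset.count_sum']
    simp only [Multiset.count_replicate]
    rw [Finset.sum_eq_single b]
    · simp
    · intro c _ hc
      rw [if_neg]
      intro h
      exact hc (Fin.ext (by omega))
    · simp

lemma psumHom_monomial_multExp {n : ℕ} {R : Type*} [CommRing R] (mu : N.Partition) :
    psumHom n N R (monomial (multExp mu) 1) = psumPart (Fin n) R mu := by
  classical
  rw [psumPart, Finset.prod_multiset_map_count, prod_toFinset_eq_prod_fin mu
    (fun k => psum (Fin n) R k ^ mu.parts.count k) (fun k hk => by
      rw [Multiset.count_eq_zero_of_notMem hk, pow_zero]), psumHom, aeval_monomial, map_one, one_mul,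
    Finsupp.prod_fintype _ _ (by simp)]
  rfl

lemma normWeight_multExp {R : Type*} [CommRing R] (a : R) (mu : N.Partition) :
    normWeight a (multExp mu) = (zee mu : R) * a ^ len mu := by
  classical
  have h1 := prod_toFinset_eq_prod_fin mu
    (fun k => ((mu.parts.count k).factorial : R) * (a * (k : R)) ^ mu.parts.count k) (fun k hk => by
      rw [Multiset.count_eq_zero_of_notMem hk]; simp)
  rw [normWeight, zee, len, ← Multiset.toFinset_sum_count_eq, ← Finset.prod_pow_eq_pow_sum,
    Nat.cast_prod, ← Finset.prod_mul_distrib]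
  simp only [multExp_apply]
  rw [← h1]
  refine Finset.prod_congr rfl fun k _ => ?_
  rw [mul_pow]
  push_cast
  ring

lemma eq_sum_monomial_multExp {R : Type*} [CommRing R] {f : MvPolynomial (Fin N) R}
    (hf : IsWeightedHomogeneous (psWeight N) f N) :
    f = ∑ mu : N.Partition, coeff (multExp mu) f • monomial (multExp mu) 1 := by
  classical
  ext u
  simp only [coeff_sum, coeff_smul, coeff_monomial, smul_eq_mul, mul_ite, mul_one, mul_zero]
  by_cases hu : Finsupp.weight (psWeight N) u = N
  · obtain ⟨mu, rfl⟩ := exists_multExp hu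
    rw [Finset.sum_eq_single mu]
    · simp
    · intro nu _ hnu
      rw [if_neg fun h => hnu (multExp_injective h)]
    · simp
  · rw [hf.coeff_eq_zero u hu, Finset.sum_eq_zero]
    intro mu _
    rw [if_neg]
    rintro rfl
    exact hu (weight_multExp mu)

end PartitionExponents

/-! ### Orthogonality of eigenfunctions and anisotropy of the form. -/

section Orthogonality

variable {n N : ℕ} (h : N ≤ n)

/-- The expression of a symmetric polynomial in terms of power sums. -/
noncomputable def toPowerSums : SymHom n N →ₗ[Qα] MvPolynomial (Fin N) Qα :=
  (powerSumBasis h).constr Qα fun mu => monomial (multExp mu) 1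

lemma powerSumBasis_eq (mu : N.Partition) : powerSumBasis h mu = pElt n mu := by
  simp [powerSumBasis]

lemma psumHom_toPowerSums (f : SymHom n N) :
    psumHom n N Qα (toPowerSums h f) = (f : MvPolynomial (Fin n) Qα) := by
  have : (psumHom n N Qα).toLinearMap ∘ₗ toPowerSums h = (SymHom n N).subtype := by
    refine (powerSumBasis h).ext fun mu => ?_
    rw [LinearMap.comp_apply, toPowerSums, Module.Basis.constr_basis]
    change psumHom n N Qα _ = ((powerSumBasis h mu : SymHom n N) : MvPolynomial (Fin n) Qα)
    rw [psumHom_monomial_multExp, powerSumBasis_apply]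
  exact LinearMap.congr_fun this f

lemma toPowerSums_isWeightedHomogeneous (f : SymHom n N) :
    IsWeightedHomogeneous (psWeight N) (toPowerSums h f) N := by
  rw [toPowerSums, Module.Basis.constr_apply_fintype]
  refine IsWeightedHomogeneous.sum _ _ _ fun mu _ => ?_
  rw [smul_eq_C_mul]
  exact (isWeightedHomogeneous_monomial _ _ _ (weight_multExp mu)).C_mul _

lemma jackForm_eq_psForm (f g : SymHom n N) :
    jackForm h f g = psForm α (toPowerSums h f) (toPowerSums h g) := by
  have : jackForm h = (psForm α).compl₁₂ (toPowerSums h) (toPowerSums h) := by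
    refine LinearMap.BilinForm.ext_basis (powerSumBasis h) fun mu nu => ?_
    rw [LinearMap.compl₁₂_apply, powerSumBasis_eq, powerSumBasis_eq, jackForm_powerSum,
      ← powerSumBasis_eq h, ← powerSumBasis_eq h, toPowerSums, Module.Basis.constr_basis,
      Module.Basis.constr_basis, psForm_monomial, coeff_monomial, one_mul, normWeight_multExp]
    by_cases hmn : mu = nu
    · subst hmn; simp
    · rw [if_neg hmn, if_neg fun h => hmn (multExp_injective h.symm), mul_zero]
  rw [this, LinearMap.compl₁₂_apply]

lemma psumHom_injective_of_isWeightedHomogeneous (h : N ≤ n) {f : MvPolynomial (Fin N) Qα}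
    (hf : IsWeightedHomogeneous (psWeight N) f N) (h0 : psumHom n N Qα f = 0) : f = 0 := by
  have h1 := h0
  rw [eq_sum_monomial_multExp hf, map_sum] at h1
  have h2 : ∑ mu : N.Partition, coeff (multExp mu) f • (pElt n mu : SymHom n N) = 0 := by
    apply Subtype.ext
    rw [Submodule.coe_sum, Submodule.coe_zero, ← h1]
    refine Finset.sum_congr rfl fun mu _ => ?_
    rw [map_smul, psumHom_monomial_multExp]
    rfl
  have h3 := Fintype.linearIndependent_iff.mp (pElt_linearIndependent h) _ h2
  rw [eq_sum_monomial_multExp hf]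
  exact Finset.sum_eq_zero fun mu _ => by rw [h3 mu, zero_smul]

/-- The operator `xiSq` is self-adjoint, so its eigenfunctions are orthogonal. -/
theorem jackForm_eq_zero_of_eigen {f g : SymHom n N} {e e' : Qα} (hne : e ≠ e')
    (hf : xiSq α (f : MvPolynomial (Fin n) Qα) = C e * (f : MvPolynomial (Fin n) Qα))
    (hg : xiSq α (g : MvPolynomial (Fin n) Qα) = C e' * (g : MvPolynomial (Fin n) Qα)) :
    jackForm h f g = 0 := by
  have key : ∀ (f : SymHom n N) (e : Qα),
      xiSq α (f : MvPolynomial (Fin n) Qα) = C e * (f : MvPolynomial (Fin n) Qα) →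
      psOp α (∑ i : Fin n, ((i : ℕ) : Qα) ^ 2) (toPowerSums h f) = e • toPowerSums h f :=
    fun f e hf => by
      have hw := toPowerSums_isWeightedHomogeneous h f
      have hw2 : IsWeightedHomogeneous (psWeight N) (e • toPowerSums h f) N := by
        rw [smul_eq_C_mul]; exact hw.C_mul e
      refine sub_eq_zero.mp (psumHom_injective_of_isWeightedHomogeneous h
        ((psOp_isWeightedHomogeneous α _ hw).sub hw2) ?_)
      rw [map_sub, ← xiSq_psumHom_eq α hw, map_smul, psumHom_toPowerSums, hf, smul_eq_C_mul,
        sub_self]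
  have h1 := psForm_psOp α (∑ i : Fin n, ((i : ℕ) : Qα) ^ 2) (toPowerSums h f) (toPowerSums h g)
  rw [key f e hf, key g e' hg, map_smul, map_smul, LinearMap.smul_apply, ← jackForm_eq_psForm,
    smul_eq_mul, smul_eq_mul] at h1
  have h2 : (e - e') * jackForm h f g = 0 := by rw [sub_mul, h1, sub_self]
  exact (mul_eq_zero.mp h2).resolve_left (sub_ne_zero.mpr hne)

/-- The form is anisotropic, since it is positive definite for all positive rational values of
the parameter. -/
theorem jackForm_self_eq_zero {f : SymHom n N} (hf : jackForm h f f = 0) : f = 0 := by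
  classical
  set c := (powerSumBasis h).repr f with hc
  have h1 : jackForm h f f = ∑ mu : N.Partition, (zee mu : Qα) * α ^ len mu * c mu ^ 2 := by
    have hrep := (powerSumBasis h).sum_repr f
    conv_lhs => rw [← hrep]
    simp only [map_sum, LinearMap.sum_apply, map_smul, LinearMap.smul_apply, powerSumBasis_eq,
      jackForm_powerSum, smul_eq_mul, mul_ite, mul_zero, Finset.sum_ite_eq',
      Finset.mem_univ, if_true]
    exact Finset.sum_congr rfl fun mu _ => by ring
  obtain ⟨⟨q, hq⟩, hb⟩ := IsLocalization.exist_integer_multiples_of_finite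
    (nonZeroDivisors (Polynomial ℚ)) (fun mu => c mu)
  choose P hP using hb
  have hq0 : q ≠ 0 := nonZeroDivisors.ne_zero hq
  -- Multiplication by the square of a common denominator q turns the norm into a polynomial
  -- identity.
  have h2 : ∑ mu : N.Partition, Polynomial.C (zee mu : ℚ) * Polynomial.X ^ len mu * P mu ^ 2 = 0 := by
    apply RatFunc.algebraMap_injective ℚ
    rw [map_zero, map_sum]
    have h3 : ∀ mu, algebraMap (Polynomial ℚ) Qα (Polynomial.C (zee mu : ℚ) * Polynomial.X ^ len mu
        * P mu ^ 2) = algebraMap (Polynomial ℚ) Qα q ^ 2 *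
          ((zee mu : Qα) * α ^ len mu * c mu ^ 2) := fun mu => by
      have := hP mu
      rw [Algebra.smul_def] at this
      simp only at this
      rw [map_mul, map_mul, map_pow, map_pow, this, RatFunc.algebraMap_X, Polynomial.C_eq_natCast,
        map_natCast]
      ring
    rw [Finset.sum_congr rfl fun mu _ => h3 mu, ← Finset.mul_sum, ← h1, hf, mul_zero]
  have hzee : ∀ mu : N.Partition, 0 < zee mu := fun mu => by
    refine Finset.prod_pos fun i hi => Nat.mul_pos (Nat.pow_pos ?_) (Nat.factorial_pos _)
    exact mu.parts_pos (Multiset.mem_toFinset.mp hi)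
  -- At a positive rational t all summands are nonnegative, so each P vanishes at infinitely many
  -- points.
  have h4 : ∀ mu, P mu = 0 := fun mu => by
    refine Polynomial.eq_zero_of_infinite_isRoot _ (Set.Infinite.mono (s := Set.Ioi 0) ?_
      (Set.Ioi_infinite 0))
    intro t ht
    have ht' : (0 : ℚ) < t := ht
    have h5 := congrArg (Polynomial.eval t) h2
    rw [Polynomial.eval_finsetSum, Polynomial.eval_zero] at h5
    have h6 := (Finset.sum_eq_zero_iff_of_nonneg fun nu _ => ?_).mp h5 mu (Finset.mem_univ mu)
    · simp only [Polynomial.eval_mul, Polynomial.eval_C, Polynomial.eval_pow, Polynomial.eval_X,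
        mul_eq_zero, pow_eq_zero_iff two_ne_zero] at h6
      rcases h6 with (h6 | h6) | h6
      · exact absurd h6 (by exact_mod_cast (hzee mu).ne')
      · exact absurd h6 (pow_pos ht' _).ne'
      · simpa using h6
    · simp only [Polynomial.eval_mul, Polynomial.eval_C, Polynomial.eval_pow, Polynomial.eval_X]
      positivity
  have h7 : c = 0 := by
    ext mu
    have := hP mu
    rw [h4 mu, map_zero, Algebra.smul_def, eq_comm, mul_eq_zero] at this
    refine this.resolve_left ?_
    simpa using hq0
  rw [hc] at h7
  exact (powerSumBasis h).repr.map_eq_zero_iff.mp h7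

end Orthogonality

/-! ### Coefficients in the basis of symmetric monomials. -/

section MonomialSymmetric

variable {n N : ℕ}

lemma vals_toFinsupp (s : Multiset (Fin n)) : vals (Multiset.toFinsupp s) = s.dedup.map s.count := by
  classical
  rw [vals, Multiset.toFinsupp_support, Multiset.toFinset_val]
  exact Multiset.map_congr rfl fun i _ => Multiset.toFinsupp_apply s i

lemma prod_map_X {R : Type*} [CommSemiring R] (s : Multiset (Fin n)) :
    (s.map (X : Fin n → MvPolynomial (Fin n) R)).prod = monomial (Multiset.toFinsupp s) 1 := by
  induction s using Multiset.induction with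
  | empty => simp
  | cons i s ih =>
    rw [Multiset.map_cons, Multiset.prod_cons, ih, ← Multiset.singleton_add, map_add,
      Multiset.toFinsupp_singleton, X, monomial_mul, one_mul]

lemma coeff_msymm {R : Type*} [CommSemiring R] (mu : N.Partition) (d : Fin n →₀ ℕ)
    [Decidable (vals d = mu.parts)] :
    coeff d (msymm (Fin n) R mu) = if vals d = mu.parts then 1 else 0 := by
  classical
  rw [msymm, coeff_sum]
  have hv : ∀ s : {a : Sym (Fin n) N // Nat.Partition.ofSym a = mu},
      vals (Multiset.toFinsupp s.1.1) = mu.parts := fun s => by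
    rw [vals_toFinsupp]
    exact congrArg Nat.Partition.parts s.2
  simp only [prod_map_X, coeff_monomial]
  split_ifs with hd
  · have hcard : (Finsupp.toMultiset d).card = N := by
      rw [Finsupp.card_toMultiset, ← mu.parts_sum, ← hd]
      rfl
    have hof : Nat.Partition.ofSym (⟨Finsupp.toMultiset d, hcard⟩ : Sym (Fin n) N) = mu := by
      refine Nat.Partition.ext ?_
      rw [← hd]
      change (Finsupp.toMultiset d).dedup.map (Finsupp.toMultiset d).count = _
      rw [← vals_toFinsupp, Finsupp.toMultiset_toFinsupp]
    rw [Finset.sum_eq_single ⟨⟨Finsupp.toMultiset d, hcard⟩, hof⟩]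
    · rw [if_pos (Finsupp.toMultiset_toFinsupp d)]
    · rintro s - hs
      rw [if_neg]
      rintro rfl
      refine hs (Subtype.ext (Subtype.ext ?_))
      change s.1.1 = Finsupp.toMultiset (Multiset.toFinsupp s.1.1)
      rw [Multiset.toFinsupp_toMultiset]
    · simp
  · refine Finset.sum_eq_zero fun s _ => if_neg ?_
    rintro rfl
    exact hd (hv s)

open Classical in
lemma IsJackFamily.coeff_expo {h : N ≤ n} {J : N.Partition → SymHom n N}
    {v : N.Partition → N.Partition → Qα} (hJ : IsJackFamily h J v) (lam mu : N.Partition) :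
    coeff (expo h mu) (J lam : MvPolynomial (Fin n) Qα) = if DomLE mu lam then v lam mu else 0 := by
  rw [hJ.expansion, coeff_sum]
  simp only [coeff_smul, coeff_msymm, vals_expo, smul_eq_mul, mul_ite, mul_one, mul_zero]
  have : ∀ nu : N.Partition, (mu.parts = nu.parts) = (mu = nu) := fun nu =>
    propext ⟨Nat.Partition.ext, congrArg _⟩
  simp only [this, Finset.sum_ite_eq, Finset.mem_filter, Finset.mem_univ, true_and]

end MonomialSymmetric

/-! ### Dominance as a partial order. -/

section DominanceOrder

variable {N : ℕ}

lemma DomLE.refl (lam : N.Partition) : DomLE lam lam := fun _ => le_rfl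

lemma DomLE.trans {lam mu nu : N.Partition} (h₁ : DomLE lam mu) (h₂ : DomLE mu nu) :
    DomLE lam nu := fun i => (h₁ i).trans (h₂ i)

lemma DomLE.antisymm {lam mu : N.Partition} (h₁ : DomLE lam mu) (h₂ : DomLE mu lam) :
    lam = mu := by
  refine eq_of_domLE_of_sum_eq h₁ (card_parts_le mu) (card_parts_le lam)
    (Finset.sum_congr rfl fun i _ => ?_)
  have h3 := le_antisymm (h₁ i) (h₂ i)
  have h4 := le_antisymm (h₁ (i + 1)) (h₂ (i + 1))
  rw [partialSum_eq, partialSum_eq] at h3 h4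
  rw [Finset.sum_range_succ, Finset.sum_range_succ, h3] at h4
  rw [Nat.add_left_cancel h4]

lemma onePart_domLE (lam : N.Partition) : DomLE (onePart N) lam := by
  refine domLE_of_excess fun t => ?_
  cases t with
  | zero =>
    simp only [Nat.sub_zero, Multiset.map_id']
    rw [lam.parts_sum, (onePart N).parts_sum]
  | succ t => simp [onePart]

/-- Well-founded induction on the dominance order. -/
lemma DomLE.induction {p : N.Partition → Prop}
    (ih : ∀ lam, (∀ mu, DomLE mu lam → mu ≠ lam → p mu) → p lam) (lam : N.Partition) : p lam := by
  classical
  generalize hk : (Finset.univ.filter fun mu => DomLE mu lam).card = k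
  induction k using Nat.strong_induction_on generalizing lam with
  | _ k IH =>
    refine ih lam fun mu hmu hne => IH _ ?_ mu rfl
    rw [← hk]
    refine Finset.card_lt_card ((Finset.ssubset_iff_of_subset fun nu hnu => ?_).mpr
      ⟨lam, ?_, ?_⟩)
    · simp only [Finset.mem_filter, Finset.mem_univ, true_and] at hnu ⊢
      exact hnu.trans hmu
    · simpa using DomLE.refl lam
    · simpa using fun h => hne (hmu.antisymm h)

end DominanceOrder

/-- Linearly independent vectors indexed by a set of coordinates and supported there span all
vectors supported there. -/
lemma exists_eq_sum_of_coordinates {K W ι : Type*} [Field K] [AddCommGroup W] [Module K W]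
    {ρ : W →ₗ[K] (ι → K)} (hρ : Function.Injective ρ) {p : ι → Prop} [Fintype {i // p i}]
    {b : {i // p i} → W} (hb : LinearIndependent K b) (hbp : ∀ k i, ¬ p i → ρ (b k) i = 0)
    {f : W} (hf : ∀ i, ¬ p i → ρ f i = 0) : ∃ c : {i // p i} → K, f = ∑ k, c k • b k := by
  have hli : LinearIndependent K fun k => LinearMap.funLeft K K (Subtype.val : {i // p i} → ι)
      (ρ (b k)) := by
    rw [Fintype.linearIndependent_iff] at hb ⊢
    intro g hg
    refine hb g (hρ ?_)
    rw [map_zero]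
    ext i
    by_cases hi : p i
    · have := congrFun hg ⟨i, hi⟩
      simpa [Finset.sum_apply, LinearMap.funLeft_apply] using this
    · simp [Finset.sum_apply, hbp _ i hi]
  -- There are as many vectors as coordinates satisfying `p`, so independence after restriction
  -- implies spanning.
  have hspan := hli.span_eq_top_of_card_eq_finrank' (by simp)
  have hmem : LinearMap.funLeft K K (Subtype.val : {i // p i} → ι) (ρ f) ∈
      Submodule.span K (Set.range fun k => LinearMap.funLeft K K
        (Subtype.val : {i // p i} → ι) (ρ (b k))) := hspan ▸ Submodule.mem_top
  obtain ⟨c, hc⟩ := (Submodule.mem_span_range_iff_exists_fun K).mp hmem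
  refine ⟨c, hρ ?_⟩
  ext i
  by_cases hi : p i
  · have := congrFun hc.symm ⟨i, hi⟩
    simpa [Finset.sum_apply, LinearMap.funLeft_apply] using this
  · simp [Finset.sum_apply, hbp _ i hi, hf i hi]

/-! ### Uniqueness of the Jack polynomials. -/

section Uniqueness

variable {n N : ℕ} {h : N ≤ n} {J : N.Partition → SymHom n N}
  {v : N.Partition → N.Partition → Qα}

lemma IsJackFamily.coeff_onePart (hJ : IsJackFamily h J v) (lam : N.Partition) :
    coeff (expo h (onePart N)) (J lam : MvPolynomial (Fin n) Qα) = N.factorial := by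
  rw [hJ.coeff_expo, if_pos (onePart_domLE lam), hJ.normalized]

lemma IsJackFamily.form_self_ne_zero (hJ : IsJackFamily h J v) (lam : N.Partition) :
    jackForm h (J lam) (J lam) ≠ 0 := fun h0 => by
  have h1 := hJ.coeff_onePart lam
  rw [jackForm_self_eq_zero h h0, Submodule.coe_zero, coeff_zero] at h1
  exact Nat.cast_ne_zero.mpr N.factorial_ne_zero h1.symm

open Classical in
/-- A symmetric polynomial all of whose monomials are dominated by `lam` is a combination of the
`J mu` with `mu ≤ lam`. -/
lemma IsJackFamily.exists_eq_sum (hJ : IsJackFamily h J v) {lam : N.Partition} {f : SymHom n N}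
    (hf : ∀ mu, ¬ DomLE mu lam → coeff (expo h mu) (f : MvPolynomial (Fin n) Qα) = 0) :
    ∃ c : {mu : N.Partition // DomLE mu lam} → Qα, f = ∑ mu, c mu • J mu.1 := by
  refine exists_eq_sum_of_coordinates (coeffMap_injective h) (p := fun mu => DomLE mu lam)
    ?_ (fun mu nu hnu => ?_) hf
  · rw [Fintype.linearIndependent_iff]
    intro g hg nu
    have h2 := congrArg (fun x => jackForm h x (J nu.1)) hg
    simp only [map_sum, LinearMap.sum_apply, map_smul, LinearMap.smul_apply, map_zero,
      LinearMap.zero_apply, smul_eq_mul] at h2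
    rw [Finset.sum_eq_single nu] at h2
    · exact (mul_eq_zero.mp h2).resolve_right (hJ.form_self_ne_zero _)
    · intro mu _ hmu
      rw [hJ.orthogonal _ _ fun h => hmu (Subtype.ext h), mul_zero]
    · simp
  · change coeff (expo h nu) (J mu.1 : MvPolynomial (Fin n) Qα) = 0
    rw [hJ.coeff_expo, if_neg fun h => hnu (h.trans mu.2)]

/-- The Jack polynomials are characterised by triangularity, normalization, and orthogonality of
comparable members of the family. -/
theorem IsJackFamily.eq_of_triangular (hJ : IsJackFamily h J v) {S : N.Partition → SymHom n N}
    (htri : ∀ lam mu, ¬ DomLE mu lam → coeff (expo h mu) (S lam : MvPolynomial (Fin n) Qα) = 0)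
    (hnorm : ∀ lam, coeff (expo h (onePart N)) (S lam : MvPolynomial (Fin n) Qα) = N.factorial)
    (horth : ∀ lam mu, DomLE mu lam → mu ≠ lam → jackForm h (S lam) (S mu) = 0)
    (lam : N.Partition) : J lam = S lam := by
  classical
  induction lam using DomLE.induction with
  | ih lam IH =>
    obtain ⟨c, hc⟩ := hJ.exists_eq_sum (htri lam)
    -- By induction S_μ = J_μ for μ below λ, so pairing S_λ with it isolates the coefficient c_μ
    -- times a nonzero norm.
    have hc0 : ∀ mu : {mu : N.Partition // DomLE mu lam}, mu.1 ≠ lam → c mu = 0 := fun mu hmu => by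
      have h1 := horth lam mu.1 mu.2 hmu
      rw [← IH mu.1 mu.2 hmu, hc] at h1
      simp only [map_sum, LinearMap.sum_apply, map_smul, LinearMap.smul_apply, smul_eq_mul] at h1
      rw [Finset.sum_eq_single mu] at h1
      · exact (mul_eq_zero.mp h1).resolve_right (hJ.form_self_ne_zero _)
      · intro nu _ hnu
        rw [hJ.orthogonal _ _ fun h => hnu (Subtype.ext h), mul_zero]
      · simp
    have hS : S lam = c ⟨lam, DomLE.refl lam⟩ • J lam := by
      rw [hc, Finset.sum_eq_single ⟨lam, DomLE.refl lam⟩]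
      · intro nu _ hnu
        rw [hc0 nu fun h => hnu (Subtype.ext h), zero_smul]
      · simp
    have h1 := hnorm lam
    rw [hS, Submodule.coe_smul, coeff_smul, hJ.coeff_onePart, smul_eq_mul] at h1
    have h2 : (N.factorial : Qα) ≠ 0 := Nat.cast_ne_zero.mpr N.factorial_ne_zero
    rw [hS, mul_right_cancel₀ h2 (h1.trans (one_mul _).symm), one_smul]

end Uniqueness

/-! ### Integrality of the Jack polynomials. -/

/-- Substitution of the parameter into integer polynomials. -/
noncomputable def evalParam : Polynomial ℤ →+* Qα := (Polynomial.aeval α).toRingHom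

lemma evalParam_X : evalParam Polynomial.X = α := Polynomial.aeval_X α

lemma evalParam_injective : Function.Injective evalParam := by
  have : evalParam = (algebraMap (Polynomial ℚ) Qα).comp
      (Polynomial.mapRingHom (Int.castRingHom ℚ)) := by
    refine Polynomial.ringHom_ext (fun z => by simp) ?_
    rw [evalParam_X]
    simp
  rw [this]
  exact (RatFunc.algebraMap_injective ℚ).comp
    (Polynomial.map_injective _ (RingHom.injective_int _))

/-- The Jack polynomials have coefficients in `ℤ[α]`. -/
theorem IsJackFamily.exists_integral {n N : ℕ} {h : N ≤ n + 1}
    {J : N.Partition → SymHom (n + 1) N} {v : N.Partition → N.Partition → Qα}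
    (hJ : IsJackFamily h J v) (lam : N.Partition) :
    ∃ S : MvPolynomial (Fin (n + 1)) (Polynomial ℤ),
      (J lam : MvPolynomial (Fin (n + 1)) Qα) = map evalParam S := by
  choose S e hsym hhom hone htri heig he using
    fun lam : N.Partition => exists_symmetric_eigenfunction h lam
  have hmem : ∀ lam, map evalParam (S lam) ∈ SymHom (n + 1) N := fun lam =>
    ⟨fun σ => by rw [← map_rename, hsym lam σ], (hhom lam).map evalParam⟩
  have hE : ∀ lam, xiSq α (map evalParam (S lam)) =
      C (evalParam (e lam)) * map evalParam (S lam) := fun lam => by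
    rw [← evalParam_X, ← map_xiSq, heig, map_mul, map_C]
  refine ⟨S lam, congrArg Subtype.val (hJ.eq_of_triangular (S := fun lam => ⟨_, hmem lam⟩)
    (fun lam mu hmu => ?_) (fun lam => ?_) (fun lam mu hmu hne => ?_) lam)⟩
  · change coeff _ (map evalParam (S lam)) = 0
    rw [coeff_map]
    by_contra h0
    exact hmu (htri lam _ mu (vals_expo h mu) fun h1 => h0 (by rw [h1, map_zero]))
  · change coeff _ (map evalParam (S lam)) = _
    have hv := vals_expo h (onePart N)
    rw [coeff_map, hone, map_natCast]
    · intro i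
      by_contra! hi
      have h1 : expo h (onePart N) i ∈ (onePart N).parts := by
        rw [← hv]
        exact Multiset.mem_map_of_mem _ (Finsupp.mem_support_iff.mpr (by omega))
      have := Multiset.eq_of_mem_replicate h1
      omega
    · have h1 := vals_sum (expo h (onePart N))
      rw [hv, (onePart N).parts_sum, Finsupp.degree_eq_sum] at h1
      exact h1.symm
  -- If the eigenvalues agreed, so would their coefficients of α, contradicting that ∑ (i−1) λ_i
  -- separates comparable partitions.
  · refine jackForm_eq_zero_of_eigen h (fun h1 => hne ?_) (hE lam) (hE mu)
    have h2 := congrArg (fun p => Polynomial.coeff p 1) (evalParam_injective h1)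
    simp only [he] at h2
    exact eq_of_domLE_of_sum_eq hmu ((card_parts_le lam).trans h) ((card_parts_le mu).trans h)
      (by omega)

end JackPoly

theorem theorem2 {n N : ℕ} (h : N ≤ n) (J : N.Partition → JackPoly.SymHom n N)
    (v : N.Partition → N.Partition → JackPoly.Qα) (hJ : JackPoly.IsJackFamily h J v)
    (lam mu : N.Partition) (hle : JackPoly.DomLE mu lam) :
    ∃ P : Polynomial ℤ, v lam mu = Polynomial.aeval JackPoly.α P := by
  cases n with
  -- The construction needs at least one variable; without variables N = 0, and normalization gives
  -- the only coefficient.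
  | zero =>
    obtain rfl : N = 0 := Nat.le_zero.mp h
    refine ⟨1, ?_⟩
    rw [Subsingleton.elim mu (JackPoly.onePart 0), hJ.normalized, map_one, Nat.factorial_zero,
      Nat.cast_one]
  | succ n =>
    obtain ⟨S, hS⟩ := hJ.exists_integral lam
    refine ⟨MvPolynomial.coeff (JackPoly.expo h mu) S, ?_⟩
    have h1 := hJ.coeff_expo lam mu
    rw [if_pos hle, hS, MvPolynomial.coeff_map] at h1
    exact h1.symm
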